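/- Let $\mathbf{k}$ be a commutative unital ring of finite global dimension and let $M$ be a real $C^\infty$ manifold (of dimension $n\ge 0$, Hausdorff and second countable). For a manifold $X$, let $D^b(\mathbf{k}_X)$ be the bounded derived category of sheaves of $\mathbf{k}$-modules on $X$. The microsupport $SS(F)\subset T^*X$ of $F\in D^b(\mathbf{k}_X)$ is defined as follows: $p\notin SS(F)$ if there is an open neighborhood $U$ of $p$ in $T^*X$ such that $(R\Gamma_{\{\varphi\ge 0\}}F)_{x_0}\simeq 0$ for every $x_0\in X$ and every real $C^1$-function $\varphi$ defined in a neighborhood of $x_0$ with $\varphi(x_0)=0$ and $d\varphi(x_0)\in U$. On $M\times\mathbb{R}$ let $t$ be the coordinate of $\mathbb{R}$ and write covectors as $\xi\,dx+\tau\,dt$. Let $D^b_{\tau\ge0}(\mathbf{k}_{M\times\mathbb{R}})$ (resp. $D^b_{\tau\le0}(\mathbf{k}_{M\times\mathbb{R}})$) be the full triangulated subcategory of $D^b(\mathbf{k}_{M\times\mathbb{R}})$ of the $F$ with $SS(F)\subset\{\tau\ge0\}$ (resp. $SS(F)\subset\{\tau\le0\}$). Set $T_c(x,t)=(x,t+c)$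 for $c\in\mathbb{R}$. With $q_1,q_2,s\colon M\times\mathbb{R}\times\mathbb{R}\to M\times\mathbb{R}$, $q_1(x,t,v)=(x,t)$, $q_2(x,t,v)=(x,v)$, $s(x,t,v)=(x,t+v)$, put $F\star_{np}G=Rs_*(q_1^{-1}F\otimes^{L}q_2^{-1}G)$. For $F\in D^b_{\tau\ge0}(\mathbf{k}_{M\times\mathbb{R}})$ the restriction $\mathbf{k}_{M\times[c,\infty[}\to\mathbf{k}_{M\times\{c\}}$ induces an isomorphism $F\star_{np}\mathbf{k}_{M\times[c,\infty[}\simeq T_{c*}F$, and for $c\le d$ the restriction $\mathbf{k}_{M\times[c,\infty[}\to\mathbf{k}_{M\times[d,\infty[}$ thus induces a morphism $\tau_{c,d}(F)\colon T_{c*}F\to T_{d*}F$. An object $F$ of $D^b_{\tau\ge0}(\mathbf{k}_{M\times\mathbb{R}})$ is called torsion if $\tau_{0,c}(F)\colon F\to T_{c*}F$ vanishes for some $c\ge0$; let $\mathcal{N}_{tor}$ be the full subcategory of torsion objects of $D^b_{\tau\ge0}(\mathbf{k}_{M\times\mathbb{R}})$. Let $D^b(\mathbf{k}^\gamma_M)=D^b(\mathbf{k}_{M\times\mathbb{R}})/D^b_{\tau\le0}(\mathbf{k}_{M\times\mathbb{R}})$.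 It is equivalent, through the localization functor, to the left orthogonal $\{F : \mathrm{Hom}(F,G)=0 \text{ for all } G\in D^b_{\tau\le0}(\mathbf{k}_{M\times\mathbb{R}})\}$, which is contained in $D^b_{\tau\ge0}(\mathbf{k}_{M\times\mathbb{R}})$. Let $\mathcal{N}^\gamma_{tor}$ be the full subcategory of $D^b(\mathbf{k}^\gamma_M)$ of the objects isomorphic to the image of a torsion object of this left orthogonal, and let $\mathcal{T}(\mathbf{k}_M)=D^b(\mathbf{k}^\gamma_M)/\mathcal{N}^\gamma_{tor}$, that is, the localization of $D^b(\mathbf{k}^\gamma_M)$ at the morphisms which have a cone in $\mathcal{N}^\gamma_{tor}$. A null system in a triangulated category is a full triangulated subcategory which is closed under isomorphisms. Theorem. (i) $\mathcal{N}_{tor}$ is a null system in $D^b_{\tau\ge0}(\mathbf{k}_{M\times\mathbb{R}})$. (ii) Consequently, $\mathcal{N}^\gamma_{tor}$ is a null system in $D^b(\mathbf{k}^\gamma_M)$, and $\mathcal{T}(\mathbf{k}_M)$ is a triangulated category, with a triangulated structure for which the localization functor $D^b(\mathbf{k}^\gamma_M)\to\mathcal{T}(\mathbf{k}_M)$ is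 triangulated. -/

import Mathlib

open CategoryTheory Limits TopologicalSpace
open scoped Manifold ContDiff

universe u

noncomputable section

namespace Tamarkin

/-! ### Bounded below derived categories: exact functors and right derived functors -/

section Derived

variable {C D : Type*} [Category* C] [Category* D] [Abelian C] [Abelian D]
  [HasDerivedCategory C] [HasDerivedCategory D]

section Exact

variable (F : C ⥤ D) [F.Additive] [PreservesFiniteLimits F] [PreservesFiniteColimits F]

lemma plus_mapDerivedCategory_obj (K : DerivedCategory.Plus C) :
    DerivedCategory.TStructure.t.plus (F.mapDerivedCategory.obj K.obj) := by
  obtain ⟨K, n, L, e, h⟩ := K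
  refine ⟨n, ⟨(F.mapHomologicalComplex _).obj L, ?_, ?_⟩⟩
  · exact F.mapDerivedCategory.mapIso e ≪≫ F.mapDerivedCategoryFactors.app L
  · infer_instance

/-- The functor `D⁺(C) ⥤ D⁺(D)` induced by an exact functor. -/
def exactPlus : DerivedCategory.Plus C ⥤ DerivedCategory.Plus D :=
  DerivedCategory.TStructure.t.plus.lift (DerivedCategory.Plus.ι ⋙ F.mapDerivedCategory)
    (plus_mapDerivedCategory_obj F)

instance exactPlusCommShift : (exactPlus F).CommShift ℤ := by
  dsimp only [exactPlus]; infer_instance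

instance exactPlusIsTriangulated : (exactPlus F).IsTriangulated := by
  dsimp only [exactPlus]; infer_instance

/-- The extension of an exact functor to `D⁺` is computed termwise on complexes. -/
def exactPlusFactors :
    DerivedCategory.Plus.Qh ⋙ exactPlus F ≅
      F.mapHomotopyCategoryPlus ⋙ DerivedCategory.Plus.Qh :=
  (DerivedCategory.TStructure.t.plus.fullyFaithfulι.whiskeringRight _).preimageIso
    (Functor.isoWhiskerLeft (HomotopyCategory.Plus.ι C) F.mapDerivedCategoryFactorsh)

end Exact

/-- The natural transformation between bounded below homotopy categories induced
by a natural transformation of additive functors. -/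
def mapHomotopyPlusNatTrans {F G : C ⥤ D} [F.Additive] [G.Additive] (α : F ⟶ G) :
    F.mapHomotopyCategoryPlus ⟶ G.mapHomotopyCategoryPlus :=
  ((HomotopyCategory.plus _).fullyFaithfulι.whiskeringRight _).preimage
    (Functor.whiskerLeft (HomotopyCategory.Plus.ι C) (NatTrans.mapHomotopyCategory α (.up ℤ)))

/-- The natural isomorphism between bounded below homotopy categories induced
by an isomorphism of additive functors. -/
def mapHomotopyPlusNatIso {F G : C ⥤ D} [F.Additive] [G.Additive] (α : F ≅ G) :
    F.mapHomotopyCategoryPlus ≅ G.mapHomotopyCategoryPlus :=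
  ((HomotopyCategory.plus _).fullyFaithfulι.whiskeringRight _).preimageIso
    (Functor.isoWhiskerLeft (HomotopyCategory.Plus.ι C)
      { hom := NatTrans.mapHomotopyCategory α.hom (.up ℤ)
        inv := NatTrans.mapHomotopyCategory α.inv (.up ℤ)
        hom_inv_id := by rw [← NatTrans.mapHomotopyCategory_comp]; simp
        inv_hom_id := by rw [← NatTrans.mapHomotopyCategory_comp]; simp })

section RightDerived

/-- The equivalence between bounded below complexes of injective objects up to
homotopy and the bounded below derived category. -/
def injPlus : HomotopyCategory.Plus (InjectiveObject C) ⥤ DerivedCategory.Plus C :=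
  (InjectiveObject.ι C).mapHomotopyCategoryPlus ⋙ DerivedCategory.Plus.Qh

lemma injPlus_map_bijective (X Y : HomotopyCategory.Plus (InjectiveObject C)) :
    Function.Bijective ((injPlus (C := C)).map : (X ⟶ Y) → _) := by
  refine (DerivedCategory.Plus.Qh_map_bijective_of_isKInjective _ _ ?_).comp
    ⟨(InjectiveObject.ι C).mapHomotopyCategoryPlus.map_injective,
      (InjectiveObject.ι C).mapHomotopyCategoryPlus.map_surjective⟩
  obtain ⟨K, rfl⟩ := HomotopyCategory.Plus.quotient_obj_surjective Y
  exact inferInstanceAs (CochainComplex.IsKInjective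
    (((InjectiveObject.ι C).mapHomologicalComplex (.up ℤ)).obj K.obj))

variable (F : C ⥤ D) [F.Additive] [EnoughInjectives C]

/-- The right derived functor is computed termwise on complexes of injective objects. -/
def injPlusIso : injPlus (C := C) ⋙ F.rightDerivedFunctorPlus ≅
    (InjectiveObject.ι C).mapHomotopyCategoryPlus ⋙ F.mapHomotopyCategoryPlus ⋙
      DerivedCategory.Plus.Qh :=
  have h (X : HomotopyCategory.Plus (InjectiveObject C)) :
      IsIso (F.rightDerivedFunctorPlusUnit.app
        ((InjectiveObject.ι C).mapHomotopyCategoryPlus.obj X)) := inferInstance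
  (NatIso.ofComponents (fun X => @asIso _ _ _ _ _ (h X))
    (fun _ => F.rightDerivedFunctorPlusUnit.naturality _)).symm

instance injPlusEssSurj : (injPlus (C := C)).EssSurj := by
  dsimp only [injPlus]; infer_instance

instance injPlusFull : (injPlus (C := C)).Full := ⟨fun {X Y} => (injPlus_map_bijective X Y).2⟩

instance injPlusFaithful : (injPlus (C := C)).Faithful :=
  ⟨fun {X Y} => @((injPlus_map_bijective X Y).1)⟩

instance injPlusIsEquivalence : (injPlus (C := C)).IsEquivalence where

instance injPlusCommShift : (injPlus (C := C)).CommShift ℤ := by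
  dsimp only [injPlus]; infer_instance

instance injPlusIsTriangulated : (injPlus (C := C)).IsTriangulated := by
  dsimp only [injPlus]; infer_instance

instance injPlusIsLocalization :
    (injPlus (C := C)).IsLocalization (MorphismProperty.isomorphisms _) :=
  Functor.IsLocalization.of_isEquivalence _ _ le_rfl

instance injPlusLifting :
    Localization.Lifting (injPlus (C := C)) (MorphismProperty.isomorphisms _)
      ((InjectiveObject.ι C).mapHomotopyCategoryPlus ⋙ F.mapHomotopyCategoryPlus ⋙
        DerivedCategory.Plus.Qh) F.rightDerivedFunctorPlus :=
  ⟨injPlusIso F⟩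

instance rightDerivedPlusCommShift : F.rightDerivedFunctorPlus.CommShift ℤ :=
  Functor.commShiftOfLocalization (injPlus (C := C)) (MorphismProperty.isomorphisms _) ℤ
    ((InjectiveObject.ι C).mapHomotopyCategoryPlus ⋙ F.mapHomotopyCategoryPlus ⋙
      DerivedCategory.Plus.Qh)
    F.rightDerivedFunctorPlus

instance injPlusIsoCommShift : NatTrans.CommShift (injPlusIso F).hom ℤ :=
  inferInstanceAs (NatTrans.CommShift (Localization.Lifting.iso
    (injPlus (C := C)) (MorphismProperty.isomorphisms _)
      ((InjectiveObject.ι C).mapHomotopyCategoryPlus ⋙ F.mapHomotopyCategoryPlus ⋙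
        DerivedCategory.Plus.Qh)
      F.rightDerivedFunctorPlus).hom ℤ)

instance rightDerivedPlusIsTriangulated : F.rightDerivedFunctorPlus.IsTriangulated :=
  Functor.isTriangulated_of_precomp_iso (injPlusIso F)

end RightDerived

/-- The inclusion `D^b(C) ⥤ D⁺(C)`. -/
def boundedToPlus : DerivedCategory.Bounded C ⥤ DerivedCategory.Plus C :=
  DerivedCategory.TStructure.t.plus.lift DerivedCategory.Bounded.ι (fun K => K.property.1)

instance boundedToPlusCommShift : (boundedToPlus (C := C)).CommShift ℤ := by
  dsimp only [boundedToPlus]; infer_instance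

instance boundedToPlusIsTriangulated : (boundedToPlus (C := C)).IsTriangulated := by
  dsimp only [boundedToPlus]; infer_instance

/-- Composition of exact functors on `D⁺`. -/
def exactPlusComp {B : Type*} [Category* B] [Abelian B] [HasDerivedCategory B]
    {F : C ⥤ D} {G : D ⥤ B} {K : C ⥤ B}
    [F.Additive] [PreservesFiniteLimits F] [PreservesFiniteColimits F]
    [G.Additive] [PreservesFiniteLimits G] [PreservesFiniteColimits G]
    [K.Additive] [PreservesFiniteLimits K] [PreservesFiniteColimits K]
    (e : F ⋙ G ≅ K) : exactPlus F ⋙ exactPlus G ≅ exactPlus K :=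
  letI : Localization.Lifting DerivedCategory.Plus.Qh (HomotopyCategory.Plus.quasiIso C)
      (F.mapHomotopyCategoryPlus ⋙ G.mapHomotopyCategoryPlus ⋙ DerivedCategory.Plus.Qh)
      (exactPlus F ⋙ exactPlus G) :=
    ⟨(Functor.associator _ _ _).symm ≪≫ Functor.isoWhiskerRight (exactPlusFactors F) _ ≪≫
      Functor.associator _ _ _ ≪≫ Functor.isoWhiskerLeft _ (exactPlusFactors G)⟩
  letI : Localization.Lifting DerivedCategory.Plus.Qh (HomotopyCategory.Plus.quasiIso C)
      (K.mapHomotopyCategoryPlus ⋙ DerivedCategory.Plus.Qh) (exactPlus K) :=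
    ⟨exactPlusFactors K⟩
  Localization.liftNatIso DerivedCategory.Plus.Qh (HomotopyCategory.Plus.quasiIso C)
    (F.mapHomotopyCategoryPlus ⋙ G.mapHomotopyCategoryPlus ⋙ DerivedCategory.Plus.Qh)
    (K.mapHomotopyCategoryPlus ⋙ DerivedCategory.Plus.Qh) _ _
    ((Functor.associator _ _ _).symm ≪≫
      Functor.isoWhiskerRight (Functor.mapHomotopyCategoryPlusCompIso e) _)

/-- The identity functor induces the identity functor on bounded below homotopy categories. -/
def mapHomotopyPlusId (C : Type*) [Category* C] [Abelian C] :
    (𝟭 C).mapHomotopyCategoryPlus ≅ 𝟭 (HomotopyCategory.Plus C) :=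
  ((HomotopyCategory.plus _).fullyFaithfulι.whiskeringRight _).preimageIso
    (Functor.isoWhiskerLeft (HomotopyCategory.Plus.ι C)
      (Quotient.natIsoLift _ (Functor.isoWhiskerRight
        (Functor.mapHomologicalComplexIdIso C (.up ℤ)) (HomotopyCategory.quotient C (.up ℤ))) :
        (𝟭 C).mapHomotopyCategory (.up ℤ) ≅ 𝟭 _))

/-- The extension to `D⁺` of a functor isomorphic to the identity is isomorphic to the identity. -/
def exactPlusId {F : C ⥤ C} [F.Additive] [PreservesFiniteLimits F] [PreservesFiniteColimits F]
    (e : F ≅ 𝟭 C) : exactPlus F ≅ 𝟭 (DerivedCategory.Plus C) :=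
  letI : Localization.Lifting DerivedCategory.Plus.Qh (HomotopyCategory.Plus.quasiIso C)
      (F.mapHomotopyCategoryPlus ⋙ DerivedCategory.Plus.Qh) (exactPlus F) :=
    ⟨exactPlusFactors F⟩
  letI : Localization.Lifting DerivedCategory.Plus.Qh (HomotopyCategory.Plus.quasiIso C)
      (𝟭 _ ⋙ DerivedCategory.Plus.Qh) (𝟭 (DerivedCategory.Plus C)) :=
    ⟨Functor.rightUnitor _ ≪≫ (Functor.leftUnitor _).symm⟩
  Localization.liftNatIso DerivedCategory.Plus.Qh (HomotopyCategory.Plus.quasiIso C)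
    (F.mapHomotopyCategoryPlus ⋙ DerivedCategory.Plus.Qh)
    (𝟭 _ ⋙ DerivedCategory.Plus.Qh) _ _
    (Functor.isoWhiskerRight
      (mapHomotopyPlusNatIso e ≪≫ mapHomotopyPlusId C) _)

end Derived

/-! ### Derived categories of sheaves of modules -/

/-- Sheaves of `k`-modules on `X`. -/
abbrev Sh (k : Type u) [CommRing k] (X : TopCat.{u}) := TopCat.Sheaf (ModuleCat.{u} k) X

section Sheaves

variable (k : Type u) [CommRing k]

instance hasDerivedCategorySh (X : TopCat.{u}) : HasDerivedCategory (Sh k X) :=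
  HasDerivedCategory.standard _

instance hasDerivedCategoryMod : HasDerivedCategory (ModuleCat.{u} k) :=
  HasDerivedCategory.standard _

/-- The bounded below derived category `D⁺(k_X)`. -/
abbrev Dplus (X : TopCat.{u}) := DerivedCategory.Plus (Sh k X)

/-- The bounded derived category `D^b(k_X)`. -/
abbrev Db (X : TopCat.{u}) := DerivedCategory.Bounded (Sh k X)

variable {X Y Z : TopCat.{u}}

/-- Direct image of sheaves. -/
abbrev direct (f : X ⟶ Y) : Sh k X ⥤ Sh k Y := TopCat.Sheaf.pushforward (ModuleCat.{u} k) f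

/-- Inverse image of sheaves. -/
abbrev inverse (f : X ⟶ Y) : Sh k Y ⥤ Sh k X := TopCat.Sheaf.pullback (ModuleCat.{u} k) f

/-- Inverse image is left adjoint to direct image. -/
abbrev inverseDirectAdj (f : X ⟶ Y) : inverse k f ⊣ direct k f :=
  TopCat.Sheaf.pullbackPushforwardAdjunction (ModuleCat.{u} k) f

instance direct_additive (f : X ⟶ Y) : (direct k f).Additive where
  map_add := rfl

instance inverse_additive (f : X ⟶ Y) : (inverse k f).Additive :=
  (inverseDirectAdj k f).left_adjoint_additive

instance inverse_preservesFiniteLimits (f : X ⟶ Y) : PreservesFiniteLimits (inverse k f) := by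
  have : PreservesFiniteLimits ((Opens.map f).op.lan : (_ ⥤ ModuleCat.{u} k) ⥤ _) := inferInstance
  exact Functor.sheafPullbackConstruction.preservesFiniteLimits _ _ _ _

/-- The stalk functor at `x`. -/
abbrev stalkAt (x : X) : Sh k X ⥤ ModuleCat.{u} k :=
  TopCat.Sheaf.forget (ModuleCat.{u} k) X ⋙ TopCat.Presheaf.stalkFunctor _ x

instance stalkAt_additive (x : X) : (stalkAt k x).Additive :=
  Functor.additive_of_preserves_binary_products _

/-- The inverse image functor `f⁻¹ : D⁺(k_Y) ⥤ D⁺(k_X)`. -/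
abbrev inversePlus (f : X ⟶ Y) : Dplus k Y ⥤ Dplus k X := exactPlus (inverse k f)

/-- The derived direct image functor `Rf_* : D⁺(k_X) ⥤ D⁺(k_Y)`. -/
abbrev directPlus (f : X ⟶ Y) : Dplus k X ⥤ Dplus k Y :=
  (direct k f).rightDerivedFunctorPlus

/-- The stalk functor `D⁺(k_X) ⥤ D⁺(k)`. -/
abbrev stalkPlus (x : X) : Dplus k X ⥤ DerivedCategory.Plus (ModuleCat.{u} k) :=
  exactPlus (stalkAt k x)

/-- Functoriality of inverse images. -/
def inverseComp (f : X ⟶ Y) (g : Y ⟶ Z) : inverse k g ⋙ inverse k f ≅ inverse k (f ≫ g) :=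
  ((inverseDirectAdj k g).comp (inverseDirectAdj k f)).leftAdjointUniq (inverseDirectAdj k (f ≫ g))

/-- The inverse image by the identity map is the identity functor. -/
def inverseId (X : TopCat.{u}) : inverse k (𝟙 X) ≅ 𝟭 (Sh k X) :=
  (inverseDirectAdj k (𝟙 X)).leftAdjointUniq Adjunction.id

/-- The inverse image by the identity map is the identity functor of `D⁺(k_X)`. -/
def inversePlusId (X : TopCat.{u}) : inversePlus k (𝟙 X) ≅ 𝟭 (Dplus k X) :=
  exactPlusId (inverseId k X)

/-- The morphism of functors `f_* → (f ∘ e)_* e⁻¹` given by `G → e_* e⁻¹ G`. -/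
def directUnit (e : Z ⟶ X) (f : X ⟶ Y) : direct k f ⟶ inverse k e ⋙ direct k (e ≫ f) :=
  Functor.whiskerRight (inverseDirectAdj k e).unit (direct k f)

/-- The morphism of functors `Rf_* → R(f ∘ e)_* e⁻¹` obtained by deriving `directUnit`. -/
def directUnitPlus (e : Z ⟶ X) (f : X ⟶ Y) :
    directPlus k f ⟶ inversePlus k e ⋙ directPlus k (e ≫ f) :=
  (directPlus k f).rightDerivedDesc (direct k f).rightDerivedFunctorPlusUnit
    (HomotopyCategory.Plus.quasiIso _) _
    (Functor.whiskerRight (mapHomotopyPlusNatTrans (directUnit k e f) ≫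
        (Functor.mapHomotopyCategoryPlusCompIso (Iso.refl _)).inv) DerivedCategory.Plus.Qh ≫
      (Functor.associator _ _ _).hom ≫
      Functor.whiskerLeft _ (direct k (e ≫ f)).rightDerivedFunctorPlusUnit ≫
      (Functor.associator _ _ _).inv ≫
      Functor.whiskerRight (exactPlusFactors (inverse k e)).inv _ ≫
      (Functor.associator _ _ _).hom)

/-- For maps `p, s : A ⟶ X`, the functor `F ↦ Rs_* p⁻¹ F`. -/
def pullPush {A : TopCat.{u}} (p s : A ⟶ X) : Dplus k X ⥤ Dplus k X :=
  inversePlus k p ⋙ directPlus k s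

/-- For a map `e : A' ⟶ A` over `(p, s)`, the morphism
`Rs_* p⁻¹ F ⟶ Rs_* Re_* e⁻¹ p⁻¹ F = Rs'_* p'⁻¹ F`. -/
def pullPushRestrict {A A' : TopCat.{u}} {p s : A ⟶ X} {p' s' : A' ⟶ X} (e : A' ⟶ A)
    (hp : e ≫ p = p') (hs : e ≫ s = s') : pullPush k p s ⟶ pullPush k p' s' :=
  Functor.whiskerLeft (inversePlus k p) (directUnitPlus k e s) ≫
    (Functor.associator _ _ _).inv ≫
    Functor.whiskerRight (exactPlusComp (inverseComp k e p)).hom _ ≫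
    eqToHom (by rw [hp, hs]; rfl)

/-! ### Microsupport -/

/-- The functor `Γ_S` of sections supported in a closed subset `S` of `X`: the kernel of
`G → j_* j⁻¹ G`, where `j` is the inclusion of the complement of `S`. -/
def sectionsSupported (S : Set X) : Sh k X ⥤ Sh k X :=
  kernel (inverseDirectAdj k (TopCat.ofHom (X := (Sᶜ : Set X))
    ⟨Subtype.val, continuous_subtype_val⟩)).unit

instance sectionsSupported_additive (S : Set X) : (sectionsSupported k S).Additive where
  map_add {A B f g} := by
    let α := (inverseDirectAdj k (TopCat.ofHom (X := (Sᶜ : Set X))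
      ⟨Subtype.val, continuous_subtype_val⟩)).unit
    have : Mono ((kernel.ι α).app B) := inferInstance
    change (kernel α).map (f + g) = (kernel α).map f + (kernel α).map g
    rw [← cancel_mono ((kernel.ι α).app B)]
    simp [Preadditive.add_comp, Preadditive.comp_add]

/-- The derived functor `RΓ_S : D⁺(k_X) ⥤ D⁺(k_X)`. -/
abbrev sectionsSupportedPlus (S : Set X) : Dplus k X ⥤ Dplus k X :=
  (sectionsSupported k S).rightDerivedFunctorPlus

/-- The functor `F ↦ (RΓ_{φ ≥ 0}(F|_V))_x`, for a function `φ` on an open neighborhood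
`V` of `x`. -/
def halfSpaceStalk (X : Type u) [TopologicalSpace X] (V : Set X) (φ : X → ℝ) (x : V) :
    Db k (TopCat.of X) ⥤ DerivedCategory.Plus (ModuleCat.{u} k) :=
  boundedToPlus ⋙
    inversePlus k (TopCat.ofHom (X := V) (Y := X) ⟨Subtype.val, continuous_subtype_val⟩) ⋙
    sectionsSupportedPlus k (X := TopCat.of V) {v : V | 0 ≤ φ v} ⋙
    stalkPlus k (X := TopCat.of V) x

instance halfSpaceStalkCommShift (X : Type u) [TopologicalSpace X] (V : Set X) (φ : X → ℝ)
    (x : V) : (halfSpaceStalk k X V φ x).CommShift ℤ := by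
  dsimp only [halfSpaceStalk]; infer_instance

instance halfSpaceStalkIsTriangulated (X : Type u) [TopologicalSpace X] (V : Set X) (φ : X → ℝ)
    (x : V) : (halfSpaceStalk k X V φ x).IsTriangulated := by
  dsimp only [halfSpaceStalk]; infer_instance

end Sheaves

section Microsupport

variable {E H : Type*} [NormedAddCommGroup E] [NormedSpace ℝ E] [TopologicalSpace H]
  (I : ModelWithCorners ℝ E H) (X : Type u) [TopologicalSpace X] [ChartedSpace H X]

/-- The (total space of the) cotangent bundle `T^*X`. -/
abbrev Cotangent :=
  Bundle.TotalSpace (E →L[ℝ] ℝ) (fun x : X => TangentSpace I x →L[ℝ] Bundle.Trivial X ℝ x)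

variable {X}

/-- The point `(x, dφ(x))` of the cotangent bundle. -/
def differentialAt (φ : X → ℝ) (x : X) : Cotangent I X :=
  ⟨x, mfderiv I 𝓘(ℝ, ℝ) φ x⟩

variable [IsManifold I 1 X] (k : Type u) [CommRing k]

/-- The vanishing condition on a subset `U` of `T^*X`: `(RΓ_{φ ≥ 0} F)_{x₀} ≃ 0` for
all `x₀` and all `C¹` functions `φ` defined in an open neighborhood `V` of `x₀` such that
`φ(x₀) = 0` and `dφ(x₀) ∈ U`. -/
def VanishesOn (F : Db k (TopCat.of X)) (U : Set (Cotangent I X)) : Prop :=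
  ∀ (V : Set X) (x₀ : V) (φ : X → ℝ), IsOpen V → ContMDiffOn I 𝓘(ℝ, ℝ) 1 φ V → φ x₀ = 0 →
    differentialAt I φ x₀ ∈ U → IsZero ((halfSpaceStalk k X V φ x₀).obj F)

/-- The microsupport `SS(F)`. -/
def microsupport (F : Db k (TopCat.of X)) : Set (Cotangent I X) :=
  {p | ¬ ∃ U : Set (Cotangent I X), IsOpen U ∧ p ∈ U ∧ VanishesOn I k F U}

/-- The objects `F` of `D^b(k_X)` such that `SS(F) ⊆ S`. -/
def microsupportIn (S : Set (Cotangent I X)) : ObjectProperty (Db k (TopCat.of X)) :=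
  fun F => microsupport I k F ⊆ S

lemma microsupportIn_iff (S : Set (Cotangent I X)) (F : Db k (TopCat.of X)) :
    microsupportIn I k S F ↔ ∀ p ∉ S, ∃ U : Set (Cotangent I X), IsOpen U ∧ p ∈ U ∧
      VanishesOn I k F U := by
  constructor
  · intro h p hp
    by_contra hn
    exact hp (h hn)
  · intro h p hp
    by_contra hn
    exact hp (h p hn)

instance microsupportIn_isClosedUnderIsomorphisms (S : Set (Cotangent I X)) :
    (microsupportIn I k S).IsClosedUnderIsomorphisms where
  of_iso e h := by
    rw [microsupportIn_iff] at h ⊢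
    intro p hp
    obtain ⟨U, hU, hpU, hv⟩ := h p hp
    exact ⟨U, hU, hpU, fun V x φ h₁ h₂ h₃ h₄ =>
      (hv V x φ h₁ h₂ h₃ h₄).of_iso ((halfSpaceStalk k X V φ x).mapIso e.symm)⟩

/-- The full subcategory of `D^b(k_X)` consisting of the `F` such that `SS(F) ⊆ S` is
triangulated. -/
instance microsupportIn_isTriangulated (S : Set (Cotangent I X)) :
    (microsupportIn I k S).IsTriangulated where
  exists_zero := by
    obtain ⟨Z, hZ⟩ := HasZeroObject.zero (C := Db k (TopCat.of X))
    refine ⟨Z, hZ, ?_⟩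
    rw [microsupportIn_iff]
    exact fun p _ => ⟨Set.univ, isOpen_univ, Set.mem_univ _, fun V x φ _ _ _ _ =>
      (halfSpaceStalk k X V φ x).map_isZero hZ⟩
  isStableUnderShiftBy n := ⟨fun F h => by
    rw [microsupportIn_iff] at h
    change microsupportIn I k S _
    rw [microsupportIn_iff]
    intro p hp
    obtain ⟨U, hU, hpU, hv⟩ := h p hp
    exact ⟨U, hU, hpU, fun V x φ h₁ h₂ h₃ h₄ =>
      ((shiftFunctor _ n).map_isZero (hv V x φ h₁ h₂ h₃ h₄)).of_iso
        (((halfSpaceStalk k X V φ x).commShiftIso n).app F)⟩⟩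
  toIsTriangulatedClosed₂ := .mk' (fun T hT h₁ h₃ => by
    rw [microsupportIn_iff] at h₁ h₃ ⊢
    intro p hp
    obtain ⟨U₁, hU₁, hpU₁, hv₁⟩ := h₁ p hp
    obtain ⟨U₃, hU₃, hpU₃, hv₃⟩ := h₃ p hp
    exact ⟨U₁ ∩ U₃, hU₁.inter hU₃, ⟨hpU₁, hpU₃⟩, fun V x φ a b c d =>
      Pretriangulated.Triangle.isZero₂_of_isZero₁₃ _
        ((halfSpaceStalk k X V φ x).map_distinguished T hT)
        (hv₁ V x φ a b c d.1) (hv₃ V x φ a b c d.2)⟩)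

end Microsupport

/-! ### Null systems and localization -/

section Localization

variable {C : Type*} [Category* C] [HasZeroObject C] [HasShift C ℤ] [Preadditive C]
  [∀ n : ℤ, (shiftFunctor C n).Additive] [Pretriangulated C]

/-- A null system: a full triangulated subcategory which is closed under isomorphisms. -/
def IsNullSystem (P : ObjectProperty C) : Prop :=
  P.IsTriangulated ∧ P.IsClosedUnderIsomorphisms

/-- `D` is a triangulated category in such a way that `L : C ⥤ D` is a triangulated functor. -/
def IsTriangulatedTarget {D : Type*} [Category* D] (L : C ⥤ D) : Prop :=
  ∃ (_ : HasZeroObject D) (_ : HasShift D ℤ) (_ : Preadditive D)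
    (_ : ∀ n : ℤ, (shiftFunctor D n).Additive) (_ : Pretriangulated D) (_ : L.CommShift ℤ),
    IsTriangulated D ∧ L.IsTriangulated

end Localization

/-! ### Torsion objects -/

section Torsion

variable (k : Type u) [CommRing k] (M : Type u) [TopologicalSpace M]

/-- The closed subset `{((x, t), v) ; c ≤ v}` of `(M × ℝ) × ℝ`. -/
def Half (c : ℝ) : TopCat.{u} := TopCat.of {q : (M × ℝ) × ℝ // c ≤ q.2}

/-- The projection `((x, t), v) ↦ (x, t)`. -/
def Half.proj (c : ℝ) : Half M c ⟶ TopCat.of (M × ℝ) :=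
  TopCat.ofHom ⟨fun q => q.1.1, by fun_prop⟩

/-- The sum `((x, t), v) ↦ (x, t + v)`. -/
def Half.sum (c : ℝ) : Half M c ⟶ TopCat.of (M × ℝ) :=
  TopCat.ofHom ⟨fun q => (q.1.1.1, q.1.1.2 + q.1.2), by fun_prop⟩

/-- The inclusion of `{v ≥ d}` in `{v ≥ c}` for `c ≤ d`. -/
def Half.incl {c d : ℝ} (h : c ≤ d) : Half M d ⟶ Half M c :=
  TopCat.ofHom ⟨fun q => ⟨q.1, h.trans q.2⟩, by fun_prop⟩

/-- The map `(x, t) ↦ ((x, t), c)`, which identifies `M × ℝ` with `{v = c}`. -/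
def Half.edge (c : ℝ) : TopCat.of (M × ℝ) ⟶ Half M c :=
  TopCat.ofHom ⟨fun p => ⟨(p, c), le_rfl⟩, by fun_prop⟩

/-- The translation `T_c : (x, t) ↦ (x, t + c)`. -/
def translation (c : ℝ) : TopCat.of (M × ℝ) ⟶ TopCat.of (M × ℝ) :=
  TopCat.ofHom ⟨fun p => (p.1, p.2 + c), by fun_prop⟩

/-- The functor `T_{c*}` on `D⁺(k_{M × ℝ})`. -/
abbrev translate (c : ℝ) : Dplus k (TopCat.of (M × ℝ)) ⥤ Dplus k (TopCat.of (M × ℝ)) :=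
  directPlus k (translation M c)

/-- The non-proper convolution `F ↦ F ⋆ k_{M × [c, ∞[} = Rs_* (q₁⁻¹ F ⊗ q₂⁻¹ k_{M × [c, ∞[})`,
where `q₁, q₂, s : M × ℝ × ℝ → M × ℝ` are the two projections and the sum. Here
`q₂⁻¹ k_{M × [c, ∞[}` is the constant sheaf on the closed subset `i : Half M c → M × ℝ × ℝ`,
so that tensoring with it is the functor `i_* i⁻¹`, and thus
`F ⋆ k_{M × [c, ∞[} = R(s ∘ i)_* (q₁ ∘ i)⁻¹ F`. -/
def conv (c : ℝ) : Dplus k (TopCat.of (M × ℝ)) ⥤ Dplus k (TopCat.of (M × ℝ)) :=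
  pullPush k (Half.proj M c) (Half.sum M c)

/-- The morphism `F ⋆ k_{M × [c, ∞[} ⟶ F ⋆ k_{M × [d, ∞[` for `c ≤ d` which is induced by the
restriction morphism `k_{M × [c, ∞[} ⟶ k_{M × [d, ∞[`. -/
def convRestrict {c d : ℝ} (h : c ≤ d) : conv k M c ⟶ conv k M d :=
  pullPushRestrict k (Half.incl M h) rfl rfl

/-- The morphism `F ⋆ k_{M × [c, ∞[} ⟶ F ⋆ k_{M × {c}} = T_{c*} F` which is induced by the
restriction morphism `k_{M × [c, ∞[} ⟶ k_{M × {c}}`. -/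
def convEdge (c : ℝ) : conv k M c ⟶ translate k M c :=
  pullPushRestrict k (p' := 𝟙 _) (s' := translation M c) (Half.edge M c) rfl rfl ≫
    Functor.whiskerRight (inversePlusId k _).hom _ ≫ (Functor.leftUnitor _).hom

/-- `τ : T_{c*} F ⟶ T_{d*} F` is the morphism `τ_{c,d}(F)`: it corresponds to the morphism
`F ⋆ k_{M × [c, ∞[} ⟶ F ⋆ k_{M × [d, ∞[` through the morphisms
`F ⋆ k_{M × [a, ∞[} ⟶ T_{a*} F`, which are isomorphisms if `SS(F) ⊆ {τ ≥ 0}`. -/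
def IsTau {c d : ℝ} (h : c ≤ d) (F : Dplus k (TopCat.of (M × ℝ)))
    (τ : (translate k M c).obj F ⟶ (translate k M d).obj F) : Prop :=
  (convEdge k M c).app F ≫ τ = (convRestrict k M h).app F ≫ (convEdge k M d).app F

variable {E H : Type*} [NormedAddCommGroup E] [NormedSpace ℝ E] [TopologicalSpace H]
  (I : ModelWithCorners ℝ E H) [ChartedSpace H M]

/-- The coefficient `τ` of the covector `ξ dx + τ dt` at a point of `M × ℝ`. -/
def tauCoord (p : Cotangent (I.prod 𝓘(ℝ, ℝ)) (M × ℝ)) : ℝ :=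
  p.2 ((0 : E), (1 : ℝ))

variable [IsManifold I 1 M]

/-- The objects `F` of `D^b(k_{M × ℝ})` such that `SS(F) ⊆ {τ ≥ 0}`. -/
abbrev tauNonneg : ObjectProperty (Db k (TopCat.of (M × ℝ))) :=
  microsupportIn (I.prod 𝓘(ℝ, ℝ)) k {p | 0 ≤ tauCoord M I p}

/-- The objects `F` of `D^b(k_{M × ℝ})` such that `SS(F) ⊆ {τ ≤ 0}`. -/
abbrev tauNonpos : ObjectProperty (Db k (TopCat.of (M × ℝ))) :=
  microsupportIn (I.prod 𝓘(ℝ, ℝ)) k {p | tauCoord M I p ≤ 0}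

/-- The triangulated category `D^b_{τ ≥ 0}(k_{M × ℝ})`. -/
abbrev DbTauNonneg := (tauNonneg k M I).FullSubcategory

/-- The torsion objects: the `F` in `D^b_{τ ≥ 0}(k_{M × ℝ})` such that `τ_{0,c}(F) = 0` for
some `c ≥ 0`. -/
def torsion : ObjectProperty (DbTauNonneg k M I) :=
  fun F => ∃ (c : ℝ) (h : 0 ≤ c), IsTau k M h (boundedToPlus.obj F.obj) 0

/-- The category `D^b(k_{M × ℝ}; {τ > 0})`, the localization of `D^b(k_{M × ℝ})` by the objects
`F` such that `SS(F) ⊆ {τ ≤ 0}`. -/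
abbrev DbGamma := (tauNonpos k M I).trW.Localization

/-- The localization functor. -/
abbrev DbGamma.Q : Db k (TopCat.of (M × ℝ)) ⥤ DbGamma k M I := (tauNonpos k M I).trW.Q

/-- The torsion objects of `D^b(k_{M × ℝ}; {τ > 0})`. This category is equivalent to the left
orthogonal of the objects `G` such that `SS(G) ⊆ {τ ≤ 0}`, which is contained in
`D^b_{τ ≥ 0}(k_{M × ℝ})`, and an object is torsion if the corresponding object of this
left orthogonal is. -/
def torsionGamma : ObjectProperty (DbGamma k M I) :=
  fun Y => ∃ F : DbTauNonneg k M I, (tauNonpos k M I).leftOrthogonal F.obj ∧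
    torsion k M I F ∧ Nonempty ((DbGamma.Q k M I).obj F.obj ≅ Y)

/-- The category `T(k_M)`: the localization of `D^b(k_{M × ℝ}; {τ > 0})` by its torsion
objects. -/
abbrev TorsionLocalized := (torsionGamma k M I).trW.Localization

/-- The localization functor. -/
abbrev TorsionLocalized.Q : DbGamma k M I ⥤ TorsionLocalized k M I :=
  (torsionGamma k M I).trW.Q

end Torsion

end Tamarkin

end

/-!
Let `X = M × ℝ`, and let `φ : X ⟶ Lower M` be the identity of `X`, where `Lower M` carries the
topology of the open subsets of `X` which are lower sets along `ℝ`. If `U` is such a subset and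
`c ≥ 0`, then `T_c⁻¹ U ⊆ U`, and for a sheaf `F` on `X` the restriction from `U` to `T_c⁻¹ U` is a
morphism `r_c : φ_* F ⟶ φ_* T_{c*} F` (`lowerRest`). The proof rests on the following criterion
(`isTau_zero_iff`): for a bounded below complex `I` of injective sheaves, `0` is a morphism
`τ_{0,c}(I)` if and only if `r_c : φ_* I ⟶ φ_* T_{c*} I` is homotopic to zero.

For the criterion, let `p` and `s` be the projection and the sum `((x, t), v) ↦ (x, t + v)` on
`{v ≥ 0}`, so that `I ⋆ k_{M × [0, ∞[} = Rs_* p⁻¹ I`. The sheaf `p⁻¹ I` need not be injective, but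
its sections extend from smaller to larger "boxes" `{(x, t) ∈ U, a < t + v < b}`
(`boxFlabby_inverse_of_injective`), because the fibers of `p` on boxes are connected, so that the
sections of `p⁻¹ I` on a box are those of `I` on its projection. Sheaves with this extension
property are acyclic for `s_*` (`isIso_unit_sum`), as lifts of sections through an epimorphism can
be glued over a box: first along a fiber of `p`, then over an open subset of `X` by Zorn's lemma.
Hence `Rs_* p⁻¹ I = s_* p⁻¹ I`, and `τ_{0,c}(I)` is given by a morphism of complexes
`s_* p⁻¹ I ⟶ T_{c*} I` (`sumRest`), which vanishes in the derived category if and only if it is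
homotopic to zero, since `T_{c*} I` is a complex of injective sheaves. Finally `s_* p⁻¹ = φ⁻¹ φ_*`
(`isIso_lowerComparison`), and this morphism is adjoint to `r_c`.

The criterion reduces the stability of torsion objects by extensions to a formal argument: in a
distinguished triangle with `r_c = 0` on the first term and `r_d = 0` on the third one, the
morphism `r_d` of the second term factors through the first term, on which `r_{c+d} = r_d ≫ T_{d*}
r_c` has its second factor equal to zero; thus `r_{c+d} = 0` on the second term. The microsupport
plays no role here: the objects of `D⁺(k_X)` for which `τ_{0,c}` vanishes for some `c` form a
triangulated subcategory (`plusTorsion`), and torsion objects are an inverse image of it.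

For the quotient by the objects with `SS ⊆ {τ ≤ 0}`, the localization functor is fully faithful on
their left orthogonal, so that the image of a triangulated subcategory of this left orthogonal is
triangulated (`map_trW_Q_isTriangulated`). The last assertion is then the triangulated structure
of a Verdier quotient.
-/

open CategoryTheory Limits TopologicalSpace Opposite ZeroObject

noncomputable section

namespace Tamarkin

/-! ### Stalks of inverse images -/

section InverseStalk

variable (k : Type u) [CommRing k] {X Y Z : TopCat.{u}}

/-- The canonical morphism `F_{f x} ⟶ (f⁻¹ F)_x`. -/
def inverseStalkHom (f : X ⟶ Y) (F : Sh k Y) (x : X) :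
    TopCat.Presheaf.stalk F.obj (f x) ⟶ TopCat.Presheaf.stalk ((inverse k f).obj F).obj x :=
  (TopCat.Presheaf.stalkFunctor _ (f x)).map ((inverseDirectAdj k f).unit.app F).hom ≫
    TopCat.Presheaf.stalkPushforward _ f _ x

/-- The unit of the adjunction between inverse and direct images of sheaves, for the construction
of the inverse image as the sheafification of a left Kan extension. -/
lemma sheafAdjunctionContinuous_unit_app_hom {C D : Type*} [Category* C] [Category* D]
    (G : C ⥤ D) (J : GrothendieckTopology C) (K : GrothendieckTopology D) (A : Type*) [Category* A]
    [Functor.IsContinuous G J K] [∀ (F : Cᵒᵖ ⥤ A), G.op.HasLeftKanExtension F] [HasWeakSheafify K A]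
    (F : Sheaf J A) :
    ((Functor.sheafPullbackConstruction.sheafAdjunctionContinuous G A J K).unit.app F).hom =
      (G.op.lanAdjunction A).unit.app F.obj ≫
        Functor.whiskerLeft G.op (toSheafify K (G.op.lan.obj F.obj)) := by
  have h := Adjunction.map_restrictFullyFaithful_unit_app
      (iC := sheafToPresheaf J A) (iD := 𝟭 _)
      (L := Functor.sheafPullbackConstruction.sheafPullback G A J K)
      (R := G.sheafPushforwardContinuous A J K)
      ((G.op.lanAdjunction A).comp (sheafificationAdjunction K A))
      (fullyFaithfulSheafToPresheaf J A) (Functor.FullyFaithful.id _)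
      (Iso.refl (sheafToPresheaf J A ⋙ G.op.lan ⋙ presheafToSheaf K A))
      (Iso.refl (𝟭 (Sheaf K A) ⋙ sheafToPresheaf K A ⋙ (Functor.whiskeringLeft _ _ A).obj G.op)) F
  refine h.trans ?_
  refine (congrArg _ ((Category.comp_id _).trans (CategoryTheory.Functor.map_id _ _))).trans ?_
  refine (Category.comp_id _).trans ?_
  exact Adjunction.comp_unit_app (G.op.lanAdjunction A) (sheafificationAdjunction K A) F.obj

lemma inverse_unit_eq (f : X ⟶ Y) (F : Sh k Y) :
    ((inverseDirectAdj k f).unit.app F).hom =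
     (TopCat.Presheaf.pullbackPushforwardAdjunction (ModuleCat.{u} k) f).unit.app F.obj ≫
      ((TopCat.Presheaf.pushforward _ f).map (toSheafify (Opens.grothendieckTopology X) _) ≫
        (TopCat.Presheaf.pushforward _ f).map
          ((TopCat.Sheaf.pullbackIso (ModuleCat.{u} k) f).inv.app F).hom) := by
  have := Adjunction.unit_leftAdjointUniq_hom_app
    (Functor.sheafPullbackConstruction.sheafAdjunctionContinuous (Opens.map f) (ModuleCat.{u} k)
      (Opens.grothendieckTopology Y) (Opens.grothendieckTopology X)) (inverseDirectAdj k f) F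
  refine (congrArg (fun g => g.hom) this).symm.trans ?_
  refine Eq.trans ?_ (Category.assoc _ _ _)
  refine congrArg₂ CategoryStruct.comp ?_ ?_
  · exact sheafAdjunctionContinuous_unit_app_hom _ _ _ _ F
  · rfl

lemma stalkMap_stalkPushforward (f : X ⟶ Y) {F G : TopCat.Presheaf (ModuleCat.{u} k) X}
    (a : F ⟶ G) (x : X) :
   (TopCat.Presheaf.stalkFunctor _ (f x)).map ((TopCat.Presheaf.pushforward _ f).map a) ≫
    TopCat.Presheaf.stalkPushforward _ f G x =
   TopCat.Presheaf.stalkPushforward _ f F x ≫ (TopCat.Presheaf.stalkFunctor _ x).map a := by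
  refine TopCat.Presheaf.stalk_hom_ext _ fun U hU => ?_
  refine (TopCat.Presheaf.stalkFunctor_map_germ_assoc (C := ModuleCat.{u} k) U (f x) hU
    ((TopCat.Presheaf.pushforward _ f).map a) _).trans ?_
  refine (congrArg _ (TopCat.Presheaf.stalkPushforward_germ (ModuleCat.{u} k) ..)).trans ?_
  refine Eq.trans ?_ (TopCat.Presheaf.stalkPushforward_germ_assoc (ModuleCat.{u} k) ..).symm
  exact (TopCat.Presheaf.stalkFunctor_map_germ (C := ModuleCat.{u} k) _ _ _ a).symm

lemma stalkMap_comp_stalkPushforward (f : X ⟶ Y) {F : TopCat.Presheaf (ModuleCat.{u} k) Y}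
    {P Q R : TopCat.Presheaf (ModuleCat.{u} k) X}
    (u : F ⟶ (TopCat.Presheaf.pushforward _ f).obj P) (a : P ⟶ Q) (b : Q ⟶ R) (x : X) :
    (TopCat.Presheaf.stalkFunctor _ (f x)).map (u ≫ (TopCat.Presheaf.pushforward _ f).map a ≫
      (TopCat.Presheaf.pushforward _ f).map b) ≫ TopCat.Presheaf.stalkPushforward _ f R x =
   ((TopCat.Presheaf.stalkFunctor _ (f x)).map u ≫ TopCat.Presheaf.stalkPushforward _ f P x) ≫
    (TopCat.Presheaf.stalkFunctor _ x).map a ≫ (TopCat.Presheaf.stalkFunctor _ x).map b := by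
  rw [Functor.map_comp, Functor.map_comp]
  refine (Category.assoc _ _ _).trans (Eq.trans ?_ (Category.assoc _ _ _).symm)
  refine congrArg _ ((Category.assoc _ _ _).trans ?_)
  refine (congrArg _ (stalkMap_stalkPushforward k f b x)).trans ?_
  exact (Category.assoc _ _ _).symm.trans ((eq_whisker (stalkMap_stalkPushforward k f a x) _).trans
    (Category.assoc _ _ _))

instance (f : X ⟶ Y) (F : Sh k Y) (x : X) : IsIso (inverseStalkHom k f F x) := by
  -- The inverse image of a sheaf is the sheafification of its inverse image as a presheaf, and
  -- neither of the two steps changes the stalks.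
  have h : inverseStalkHom k f F x = TopCat.Presheaf.stalkPullbackHom _ f F.obj x ≫
     (TopCat.Presheaf.stalkFunctor _ x).map (toSheafify (Opens.grothendieckTopology X) _) ≫
     (TopCat.Presheaf.stalkFunctor _ x).map
       ((TopCat.Sheaf.pullbackIso (ModuleCat.{u} k) f).inv.app F).hom := by
    refine Eq.trans ?_ (stalkMap_comp_stalkPushforward k f _ _ _ x)
    exact eq_whisker (congrArg (TopCat.Presheaf.stalkFunctor _ (f x)).map (inverse_unit_eq k f F)) _
  rw [h]
  have h1 : IsIso (TopCat.Presheaf.stalkPullbackHom _ f F.obj x) :=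
    (TopCat.Presheaf.stalkPullbackIso _ f F.obj x).isIso_hom
  have h2 : IsIso ((TopCat.Presheaf.stalkFunctor _ x).map
      (toSheafify (Opens.grothendieckTopology X) ((TopCat.Presheaf.pullback _ f).obj F.obj))) :=
    TopCat.Presheaf.stalkFunctor_map_unit_toSheafify_isIso ..
  have h3 : IsIso ((TopCat.Presheaf.stalkFunctor _ x).map
      ((TopCat.Sheaf.pullbackIso (ModuleCat.{u} k) f).inv.app F).hom) :=
    inferInstanceAs (IsIso ((stalkAt k x).map
      ((TopCat.Sheaf.pullbackIso (ModuleCat.{u} k) f).inv.app F)))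
  exact @IsIso.comp_isIso _ _ _ _ _ _ _ h1 (@IsIso.comp_isIso _ _ _ _ _ _ _ h2 h3)

end InverseStalk

/-! ### Sections of sheaves -/

section Sections

variable {k : Type u} [CommRing k] {X Y : TopCat.{u}}

/-- The module of sections of `F` on `U`. -/
abbrev Sec (F : Sh k X) (U : Opens X) : Type u := F.obj.obj (op U)

/-- Restriction of sections. -/
def res (F : Sh k X) {U V : Opens X} (h : V ≤ U) : Sec F U →ₗ[k] Sec F V :=
  (F.obj.map (homOfLE h).op).hom

/-- The action of a morphism of sheaves on sections. -/
def secMap {F G : Sh k X} (φ : F ⟶ G) (U : Opens X) : Sec F U →ₗ[k] Sec G U :=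
  (φ.hom.app (op U)).hom

@[simp]
lemma res_res (F : Sh k X) {U V W : Opens X} (h : V ≤ U) (h' : W ≤ V) (s : Sec F U) :
    res F h' (res F h s) = res F (h'.trans h) s := by
  have := F.obj.map_comp (homOfLE h).op (homOfLE h').op
  exact (congrArg (fun g => g.hom s) this).symm

@[simp]
lemma res_self (F : Sh k X) {U : Opens X} (h : U ≤ U) (s : Sec F U) : res F h s = s := by
  have := F.obj.map_id (op U)
  exact congrArg (fun g => g.hom s) this

lemma secMap_res {F G : Sh k X} (φ : F ⟶ G) {U V : Opens X} (h : V ≤ U) (s : Sec F U) :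
    secMap φ V (res F h s) = res G h (secMap φ U s) :=
  congrArg (fun g => g.hom s) (φ.hom.naturality (homOfLE h).op)

@[simp]
lemma secMap_comp {F G K : Sh k X} (φ : F ⟶ G) (ψ : G ⟶ K) (U : Opens X) (s : Sec F U) :
    secMap (φ ≫ ψ) U s = secMap ψ U (secMap φ U s) := rfl

@[simp]
lemma secMap_zero (F G : Sh k X) (U : Opens X) (s : Sec F U) :
    secMap (0 : F ⟶ G) U s = 0 := rfl

lemma hom_ext_secMap {F G : Sh k X} {φ ψ : F ⟶ G} (h : ∀ U s, secMap φ U s = secMap ψ U s) :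
    φ = ψ := by
  apply ObjectProperty.hom_ext
  ext U s
  exact h U.unop s

lemma sec_ext (F : Sh k X) {U : Opens X} {s t : Sec F U}
    (h : ∀ x ∈ U, ∃ (V : Opens X) (_ : x ∈ V) (hV : V ≤ U), res F hV s = res F hV t) : s = t := by
  choose V hx hV e using h
  refine F.eq_of_locally_eq' (fun x : U => V x.1 x.2) U (fun x => homOfLE (hV x.1 x.2))
    (fun x hxU => Opens.mem_iSup.2 ⟨⟨x, hxU⟩, hx x hxU⟩) s t (fun x => e x.1 x.2)

lemma sec_glue (F : Sh k X) {ι : Type*} {V : Opens X} (U : ι → Opens X) (hU : ∀ i, U i ≤ V)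
    (hV : ∀ x ∈ V, ∃ i, x ∈ U i) (s : ∀ i, Sec F (U i))
    (h : ∀ i j, res F (inf_le_left : U i ⊓ U j ≤ _) (s i) =
      res F (inf_le_right : U i ⊓ U j ≤ _) (s j)) :
    ∃ t : Sec F V, ∀ i, res F (hU i) t = s i := by
  obtain ⟨t, ht, -⟩ := F.existsUnique_gluing' U V (fun i => homOfLE (hU i))
    (fun x hx => Opens.mem_iSup.2 (hV x hx)) s (fun i j => h i j)
  exact ⟨t, ht⟩

/-- The stalk of a sheaf. -/
abbrev Stalk (F : Sh k X) (x : X) : Type u := (stalkAt k x).obj F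

/-- The germ of a section. -/
def germ (F : Sh k X) {U : Opens X} {x : X} (hx : x ∈ U) (s : Sec F U) :
    Stalk F x := (TopCat.Presheaf.germ (C := ModuleCat.{u} k) F.obj U x hx).hom s

lemma germ_eq_iff (F : Sh k X) {U V : Opens X} {x : X} (hU : x ∈ U) (hV : x ∈ V) (s : Sec F U)
    (t : Sec F V) : germ F hU s = germ F hV t ↔
      ∃ (W : Opens X) (_ : x ∈ W) (h : W ≤ U) (h' : W ≤ V), res F h s = res F h' t := by
  constructor
  · intro h
    obtain ⟨W, hW, a, b, e⟩ := TopCat.Presheaf.germ_eq (C := ModuleCat.{u} k) F.obj x hU hV s t h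
    exact ⟨W, hW, a.le, b.le, e⟩
  · rintro ⟨W, hW, a, b, e⟩
    exact TopCat.Presheaf.germ_ext (C := ModuleCat.{u} k) F.obj W hW (homOfLE a) (homOfLE b) e

lemma exists_germ_eq (F : Sh k X) {x : X} (t : Stalk F x) :
    ∃ (U : Opens X) (hx : x ∈ U) (s : Sec F U), germ F hx s = t :=
  TopCat.Presheaf.exists_germ_eq (C := ModuleCat.{u} k) F.obj t

lemma stalkAt_map_germ {F G : Sh k X} (φ : F ⟶ G) {U : Opens X} {x : X} (hx : x ∈ U)
    (s : Sec F U) : ((stalkAt k x).map φ).hom (germ F hx s) = germ G hx (secMap φ U s) :=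
  TopCat.Presheaf.stalkFunctor_map_germ_apply U x hx φ.hom s

/-- A complex of sheaves is exact if and only if every section which is a cocycle is locally a
coboundary. -/
lemma exact_iff_locally_exact (S : ShortComplex (Sh k X)) :
    S.Exact ↔ ∀ (U : Opens X) (b : Sec S.X₂ U), secMap S.g U b = 0 → ∀ x ∈ U,
      ∃ (V : Opens X) (_ : x ∈ V) (hV : V ≤ U) (a : Sec S.X₁ V),
        secMap S.f V a = res S.X₂ hV b := by
  rw [TopCat.Sheaf.exact_iff_stalkFunctor_map_exact]
  constructor
  · intro H U b hb x hx
    have Hx := (ShortComplex.moduleCat_exact_iff _).1 (H x)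
    obtain ⟨a, ha⟩ := Hx (germ S.X₂ hx b)
      ((stalkAt_map_germ S.g hx b).trans (by rw [hb]; exact map_zero _))
    obtain ⟨V, hV, a, rfl⟩ := exists_germ_eq S.X₁ a
    replace ha : germ S.X₂ hV (secMap S.f V a) = germ S.X₂ hx b :=
      (stalkAt_map_germ S.f hV a).symm.trans ha
    obtain ⟨W, hW, h, h', e⟩ := (germ_eq_iff _ _ _ _ _).1 ha
    exact ⟨W, hW, h', res _ h a, by rw [secMap_res, e]⟩
  · intro H x
    refine (ShortComplex.moduleCat_exact_iff _).2 fun b hb => ?_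
    obtain ⟨U, hx, b, rfl⟩ := exists_germ_eq S.X₂ b
    replace hb : germ S.X₃ hx (secMap S.g U b) = germ S.X₃ hx (0 : Sec S.X₃ U) :=
      (stalkAt_map_germ S.g hx b).symm.trans (hb.trans (map_zero _).symm)
    obtain ⟨W, hW, h, h', e⟩ := (germ_eq_iff _ _ _ _ _).1 hb
    obtain ⟨V, hV, hVW, a, ha⟩ := H W (res _ h b) (by rw [secMap_res, e, map_zero]) x hW
    refine ⟨germ _ hV a, (stalkAt_map_germ S.f hV a).trans ?_⟩
    rw [germ_eq_iff]
    exact ⟨V, hV, le_rfl, hVW.trans h, by rw [ha]; simp⟩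

lemma mono_hom_of_mono {C A : Type*} [Category* C] [Category* A] {J : GrothendieckTopology C}
    [HasWeakSheafify J A]
    {F G : CategoryTheory.Sheaf J A} (φ : F ⟶ G) [Mono φ] : Mono φ.hom :=
  (sheafToPresheaf _ _).map_mono φ

lemma secMap_injective {F G : Sh k X} (φ : F ⟶ G) [hφ : Mono φ] (U : Opens X) :
    Function.Injective (secMap φ U) := by
  have : Mono φ.hom := @mono_hom_of_mono (Opens X) _ _ _ (Opens.grothendieckTopology X) _ _ _ φ hφ
  have : Mono (φ.hom.app (op U)) := (NatTrans.mono_iff_mono_app _).1 this (op U)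
  exact (ModuleCat.mono_iff_injective _).1 this

/-- Taking sections on an open subset is left exact. -/
lemma exists_secMap_eq {S : ShortComplex (Sh k X)} (hS : S.Exact) [Mono S.f] {U : Opens X}
    (b : Sec S.X₂ U) (hb : secMap S.g U b = 0) : ∃ a, secMap S.f U a = b := by
  choose V hx hV a ha using (exact_iff_locally_exact S).1 hS U b hb
  obtain ⟨t, ht⟩ := sec_glue S.X₁ (fun x : U => V x.1 x.2) (fun x => hV x.1 x.2)
    (fun x h => ⟨⟨x, h⟩, hx x h⟩) (fun x => a x.1 x.2) (fun x y => by
      apply secMap_injective S.f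
      simp [secMap_res, ha])
  refine ⟨t, sec_ext _ fun x h => ⟨V x h, hx x h, hV x h, ?_⟩⟩
  rw [← secMap_res, ← ha x h]
  exact congrArg _ (ht ⟨x, h⟩)

lemma isIso_of_locally_bijective {F G : Sh k X} (φ : F ⟶ G)
    (inj : ∀ (U : Opens X) (s : Sec F U), secMap φ U s = 0 → ∀ x ∈ U,
      ∃ (V : Opens X) (_ : x ∈ V) (hV : V ≤ U), res F hV s = 0)
    (surj : ∀ (U : Opens X) (t : Sec G U), ∀ x ∈ U,
      ∃ (V : Opens X) (_ : x ∈ V) (hV : V ≤ U) (s : Sec F V), secMap φ V s = res G hV t) :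
    IsIso φ := by
  have : Mono φ := by
    have := (exact_iff_locally_exact (ShortComplex.mk (0 : (0 : Sh k X) ⟶ F) φ zero_comp)).2
      fun U s hs x hx => by
        obtain ⟨V, hV, h, e⟩ := inj U s hs x hx
        exact ⟨V, hV, h, 0, by rw [e]; rfl⟩
    exact (ShortComplex.exact_iff_mono _ rfl).1 this
  have : Epi φ := by
    have := (exact_iff_locally_exact (ShortComplex.mk φ (0 : G ⟶ (0 : Sh k X)) comp_zero)).2
      fun U s _ x hx => surj U s x hx
    exact (ShortComplex.exact_iff_epi _ rfl).1 this
  exact isIso_of_mono_of_epi φ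

/-- Sections lift locally through an epimorphism of sheaves. -/
lemma exists_local_lift {F G : Sh k X} (φ : F ⟶ G) [Epi φ] {U : Opens X} (t : Sec G U) {x : X}
    (hx : x ∈ U) : ∃ (V : Opens X) (_ : x ∈ V) (hV : V ≤ U) (s : Sec F V),
      secMap φ V s = res G hV t :=
  (exact_iff_locally_exact (ShortComplex.mk φ (0 : G ⟶ (0 : Sh k X)) comp_zero)).1
    ((ShortComplex.exact_iff_epi _ rfl).2 ‹_›) U t rfl x hx

/-- Extension of sections of an injective sheaf, by lifting morphisms from the sheaf associated to
the presheaf freely generated by a section on `V` along the monomorphism to the one freely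
generated by a section on `U`. -/
lemma exists_extension_of_injective {C : Type u} [SmallCategory C] (J : GrothendieckTopology C)
    [HasSheafify J (ModuleCat.{u} k)] (F : CategoryTheory.Sheaf J (ModuleCat.{u} k)) [Injective F]
    {U V : C} (h : V ⟶ U) [Mono h] (s : F.obj.obj (op V)) :
    ∃ t : F.obj.obj (op U), (F.obj.map h.op).hom t = s := by
  let P (W : C) : Cᵒᵖ ⥤ ModuleCat.{u} k := yoneda.obj W ⋙ ModuleCat.free k
  let i : P V ⟶ P U := Functor.whiskerRight (yoneda.map h) (ModuleCat.free k)
  have : Mono i := (NatTrans.mono_iff_mono_app _).2 fun W =>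
    (ModuleCat.mono_iff_injective _).2
      (Finsupp.mapDomain_injective fun a b (e : a ≫ h = b ≫ h) => (cancel_mono h).1 e)
  have : Mono ((presheafToSheaf J (ModuleCat.{u} k)).map i) := (presheafToSheaf _ _).map_mono i
  let a : P V ⟶ F.obj :=
    { app W := ModuleCat.freeDesc (↾fun j : W.unop ⟶ V => (F.obj.map j.op).hom s)
      naturality W W' j := by
        refine ModuleCat.free_hom_ext fun x => ?_
        simp [P] }
  let adj := sheafificationAdjunction J (ModuleCat.{u} k)
  let b := Injective.factorThru ((adj.homEquiv _ F).symm a) ((presheafToSheaf J _).map i)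
  have hb : i ≫ adj.homEquiv _ _ b = a := by
    rw [← Adjunction.homEquiv_naturality_left, Injective.comp_factorThru, Equiv.apply_symm_apply]
  refine ⟨((adj.homEquiv _ _ b).app (op U)).hom (ModuleCat.freeMk (𝟙 U)), ?_⟩
  have h1 := ConcreteCategory.congr_hom ((adj.homEquiv _ _ b).naturality h.op)
    (ModuleCat.freeMk (𝟙 U))
  have h2 := ConcreteCategory.congr_hom (congr_app hb (op V)) (ModuleCat.freeMk (𝟙 V))
  refine h1.symm.trans (Eq.trans ?_ (h2.trans ?_))
  · simp [P, i]
  · refine (ModuleCat.freeDesc_apply _ _).trans ?_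
    exact congrArg (fun g => g.hom s) (F.obj.map_id (op V))

/-- Sections of an injective sheaf extend. -/
lemma res_surjective_of_injective (F : Sh k X) [hF : Injective F] {U V : Opens X} (h : V ≤ U) :
    Function.Surjective (res F h) :=
  fun s => @exists_extension_of_injective k _ (Opens X) _ (Opens.grothendieckTopology X) _ F hF
    _ _ (homOfLE h) _ s

/-- The pullback of a section of `F` to a section of `f⁻¹ F`. -/
def pullSec (f : X ⟶ Y) (F : Sh k Y) (U : Opens Y) :
    Sec F U →ₗ[k] Sec ((inverse k f).obj F) ((Opens.map f).obj U) :=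
  secMap ((inverseDirectAdj k f).unit.app F) U

lemma pullSec_res (f : X ⟶ Y) (F : Sh k Y) {U V : Opens Y} (h : V ≤ U) (s : Sec F U) :
    pullSec f F V (res F h s) =
      res _ (((Opens.map f).map (homOfLE h)).le) (pullSec f F U s) :=
  secMap_res ((inverseDirectAdj k f).unit.app F) h s

lemma inverseStalkHom_germ (f : X ⟶ Y) (F : Sh k Y) {U : Opens Y} {x : X} (hx : f x ∈ U)
    (s : Sec F U) : (inverseStalkHom k f F x).hom (germ F hx s) =
      germ (x := x) ((inverse k f).obj F) (U := (Opens.map f).obj U) hx (pullSec f F U s) := by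
  have h1 := TopCat.Presheaf.stalkFunctor_map_germ_apply (C := ModuleCat.{u} k) U (f x) hx
    ((inverseDirectAdj k f).unit.app F).hom s
  have h2 := ConcreteCategory.congr_hom (TopCat.Presheaf.stalkPushforward_germ (ModuleCat.{u} k) f
    ((inverse k f).obj F).obj U x hx) (pullSec f F U s)
  exact (congrArg (TopCat.Presheaf.stalkPushforward (ModuleCat.{u} k) f _ x).hom h1).trans h2

/-- Every section of `f⁻¹ F` is locally the pullback of a section of `F`. -/
lemma exists_pullSec_eq (f : X ⟶ Y) (F : Sh k Y) {W : Opens X} (s : Sec ((inverse k f).obj F) W)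
    {x : X} (hx : x ∈ W) : ∃ (U : Opens Y) (_ : f x ∈ U) (t : Sec F U) (V : Opens X) (_ : x ∈ V)
      (hV : V ≤ W) (hV' : V ≤ (Opens.map f).obj U), res _ hV s = res _ hV' (pullSec f F U t) := by
  obtain ⟨t, ht⟩ := ((ModuleCat.epi_iff_surjective (inverseStalkHom k f F x)).1 inferInstance)
    (germ _ hx s)
  obtain ⟨U, hU, t, rfl⟩ := exists_germ_eq F t
  replace ht := (inverseStalkHom_germ f F hU t).symm.trans ht
  obtain ⟨V, hV, h, h', e⟩ := (germ_eq_iff _ _ _ _ _).1 ht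
  exact ⟨U, hU, t, V, hV, h', h, e.symm⟩

/-- If the pullbacks of two sections of `F` agree near `x`, then these sections agree
near `f x`. -/
lemma exists_res_eq_of_pullSec_eq (f : X ⟶ Y) (F : Sh k Y) {U U' : Opens Y} (s : Sec F U)
    (s' : Sec F U') {V : Opens X} (hV : V ≤ (Opens.map f).obj U)
    (hV' : V ≤ (Opens.map f).obj U') {x : X} (hx : x ∈ V)
    (h : res _ hV (pullSec f F U s) = res _ hV' (pullSec f F U' s')) :
    ∃ (W : Opens Y) (_ : f x ∈ W) (hW : W ≤ U) (hW' : W ≤ U'), res F hW s = res F hW' s' := by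
  have hxU : f x ∈ U := hV hx
  have hxU' : f x ∈ U' := hV' hx
  refine (germ_eq_iff F hxU hxU' s s').1 ?_
  apply (ModuleCat.mono_iff_injective (inverseStalkHom k f F x)).1 inferInstance
  refine (inverseStalkHom_germ f F hxU s).trans
    (Eq.trans ?_ (inverseStalkHom_germ f F hxU' s').symm)
  exact (germ_eq_iff _ _ _ _ _).2 ⟨V, hx, hV, hV', h⟩

end Sections

/-! ### Sheaves on the half-space which are flabby along boxes -/

section Boxes

variable {k : Type u} [CommRing k] {M : Type u} [TopologicalSpace M]

/-- The open subset of `{((x, t), v) ; 0 ≤ v}` given by the conditions `(x, t) ∈ U` and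
`a < t + v < b`. -/
def box (U : Opens (M × ℝ)) (a b : ℝ) : Opens (Half M 0) where
  carrier := {q | q.1.1 ∈ U ∧ a < q.1.1.2 + q.1.2 ∧ q.1.1.2 + q.1.2 < b}
  is_open' := by
    have h : Continuous fun q : Half M 0 => q.1.1.2 + q.1.2 :=
      (continuous_snd.comp (continuous_fst.comp continuous_subtype_val)).add
        (continuous_snd.comp continuous_subtype_val)
    exact (U.isOpen.preimage (continuous_fst.comp continuous_subtype_val)).inter
      ((isOpen_lt continuous_const h).inter (isOpen_lt h continuous_const))

lemma mem_box {U : Opens (M × ℝ)} {a b : ℝ} {q : Half M 0} :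
    q ∈ box U a b ↔ q.1.1 ∈ U ∧ a < q.1.1.2 + q.1.2 ∧ q.1.1.2 + q.1.2 < b := Iff.rfl

lemma box_mono {U U' : Opens (M × ℝ)} {a b a' b' : ℝ} (hU : U' ≤ U) (ha : a ≤ a') (hb : b' ≤ b) :
    box U' a' b' ≤ box U a b :=
  fun _ h => ⟨hU h.1, ha.trans_lt h.2.1, h.2.2.trans_le hb⟩

lemma box_inf (U U' : Opens (M × ℝ)) (a b a' b' : ℝ) :
    box U a b ⊓ box U' a' b' = box (U ⊓ U') (max a a') (min b b') := by
  ext q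
  change (_ ∧ _ ∧ _) ∧ (_ ∧ _ ∧ _) ↔ (_ ∧ _) ∧ max a a' < _ ∧ _ < min b b'
  rw [max_lt_iff, lt_min_iff]
  tauto

lemma box_eq_bot (U : Opens (M × ℝ)) {a b : ℝ} (h : b ≤ a) : box U a b = ⊥ := by
  ext q
  exact ⟨fun hq => absurd (hq.2.1.trans hq.2.2) h.not_gt, fun hq => hq.elim⟩

/-- Boxes form a neighborhood basis: this is the product topology in the coordinates `(x, t)` and
`t + v`. -/
lemma exists_box_le {W : Opens (Half M 0)} {z : Half M 0} (hz : z ∈ W) :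
    ∃ (U : Opens (M × ℝ)) (_ : z.1.1 ∈ U) (ε : ℝ) (_ : 0 < ε),
      box U (z.1.1.2 + z.1.2 - ε) (z.1.1.2 + z.1.2 + ε) ≤ W := by
  obtain ⟨O, hO, hW⟩ := W.isOpen
  have hc : Continuous (fun r : (M × ℝ) × ℝ => ((r.1, r.2 - r.1.2) : (M × ℝ) × ℝ)) := by fun_prop
  have hmem : (z.1.1, z.1.1.2 + z.1.2) ∈
      (fun r : (M × ℝ) × ℝ => ((r.1, r.2 - r.1.2) : (M × ℝ) × ℝ)) ⁻¹' O := by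
    have : z ∈ Subtype.val ⁻¹' O := by rw [hW]; exact hz
    change z.1 ∈ O at this
    simpa using this
  obtain ⟨U, V, hU, hV, hzU, hzV, h⟩ := isOpen_prod_iff.1 (hO.preimage hc) _ _ hmem
  obtain ⟨ε, hε, hball⟩ := Metric.isOpen_iff.1 hV _ hzV
  refine ⟨⟨U, hU⟩, hzU, ε, hε, fun q hq => ?_⟩
  have hq' : (q.1.1, q.1.1.2 + q.1.2) ∈ U ×ˢ V := by
    refine ⟨hq.1, hball ?_⟩
    rw [Real.ball_eq_Ioo]
    exact hq.2
  have := h hq'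
  change q ∈ (W : Set (Half M 0))
  rw [← hW]
  change q.1 ∈ O
  simpa using this

/-- The hyperplane `t + v = w` does not meet the fiber of the projection at `y` if `w < y.2`, as
`v ≥ 0`, and this holds near `y` and `w`. -/
lemma exists_box_eq_bot {y : M × ℝ} {w : ℝ} (h : w < y.2) :
    ∃ (U : Opens (M × ℝ)) (_ : y ∈ U) (ε : ℝ) (_ : 0 < ε), box U (w - ε) (w + ε) = ⊥ := by
  refine ⟨⟨{r | (w + y.2) / 2 < r.2}, isOpen_lt continuous_const continuous_snd⟩,
    show (w + y.2) / 2 < y.2 by linarith, (y.2 - w) / 2, by linarith, ?_⟩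
  ext q
  refine ⟨fun hq => ?_, fun hq => hq.elim⟩
  have h1 : (w + y.2) / 2 < q.1.1.2 := hq.1
  have h2 := hq.2.2
  have h3 := q.2
  exfalso
  linarith

/-- The property of a sheaf on `{((x, t), v) ; 0 ≤ v}` that sections on boxes extend to
larger boxes. -/
def BoxFlabby (F : Sh k (Half M 0)) : Prop :=
  ∀ ⦃U U' : Opens (M × ℝ)⦄ ⦃a b a' b' : ℝ⦄ (hU : U' ≤ U) (ha : a ≤ a') (hb : b' ≤ b),
    Function.Surjective (res F (box_mono hU ha hb))

lemma BoxFlabby.surjective {F : Sh k (Half M 0)} (hF : BoxFlabby F) {U U' : Opens (M × ℝ)}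
    {a b a' b' : ℝ} {W W' : Opens (Half M 0)} (h : W' ≤ W) (hW : W = box U a b)
    (hW' : W' = box U' a' b') (hU : U' ≤ U) (ha : a ≤ a') (hb : b' ≤ b) :
    Function.Surjective (res F h) := by
  subst hW hW'
  exact hF hU ha hb

lemma boxFlabby_of_injective (F : Sh k (Half M 0)) [Injective F] : BoxFlabby F :=
  fun _ _ _ _ _ _ _ _ _ => res_surjective_of_injective F _

lemma sec_eq_of_eq_bot {X : TopCat.{u}} (F : Sh k X) {U : Opens X} (hU : U = ⊥) (s t : Sec F U) :
    s = t :=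
  sec_ext F fun x hx => by
    subst hU
    exact hx.elim

/-- Sections on boxes, of any two of which one extends the other, can be glued. -/
lemma exists_glue_of_total (F : Sh k (Half M 0)) {ι : Type*} (V : ι → Opens (M × ℝ)) {α β : ℝ}
    (s : ∀ i, Sec F (box (V i) α β))
    (h : ∀ i j, (∃ h : V i ≤ V j, res F (box_mono h le_rfl le_rfl) (s j) = s i) ∨
      (∃ h : V j ≤ V i, res F (box_mono h le_rfl le_rfl) (s i) = s j)) :
    ∃ t : Sec F (box (⨆ i, V i) α β),
      ∀ i, res F (box_mono (le_iSup V i) le_rfl le_rfl) t = s i := by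
  refine sec_glue F _ (fun i => box_mono (le_iSup V i) le_rfl le_rfl) ?_ s fun i j => ?_
  · rintro x ⟨hx, hx'⟩
    obtain ⟨p, hp⟩ := Opens.mem_iSup.1 hx
    exact ⟨p, hp, hx'⟩
  · rcases h i j with ⟨h, e⟩ | ⟨h, e⟩
    · rw [← e, res_res]
    · rw [← e, res_res]

section Exact

/-- Two local lifts of a section can be glued if the sections of the kernel on the overlap extend
to the second domain. -/
lemma exists_lift_sup {X : TopCat.{u}} {S : ShortComplex (Sh k X)} (hS : S.ShortExact)
    {W W₁ W₂ : Opens X} (c : Sec S.X₃ W) (h₁ : W₁ ≤ W) (h₂ : W₂ ≤ W)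
    (b₁ : Sec S.X₂ W₁) (b₂ : Sec S.X₂ W₂) (hb₁ : secMap S.g W₁ b₁ = res _ h₁ c)
    (hb₂ : secMap S.g W₂ b₂ = res _ h₂ c)
    (hA : Function.Surjective (res S.X₁ (inf_le_right : W₁ ⊓ W₂ ≤ W₂))) :
    ∃ b : Sec S.X₂ (W₁ ⊔ W₂), secMap S.g _ b = res _ (sup_le h₁ h₂) c ∧
      res _ le_sup_left b = b₁ := by
  have := hS.mono_f
  obtain ⟨a, ha⟩ := exists_secMap_eq hS.exact
    (res _ (inf_le_left : W₁ ⊓ W₂ ≤ W₁) b₁ - res _ (inf_le_right : W₁ ⊓ W₂ ≤ W₂) b₂) (by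
      rw [map_sub, secMap_res, secMap_res, hb₁, hb₂]
      simp)
  obtain ⟨a, rfl⟩ := hA a
  have hab : res S.X₂ (inf_le_left : W₁ ⊓ W₂ ≤ W₁) b₁ =
      res _ (inf_le_right : W₁ ⊓ W₂ ≤ W₂) (b₂ + secMap S.f W₂ a) := by
    rw [map_add, ← secMap_res, ha]
    abel
  obtain ⟨b, hb⟩ := sec_glue S.X₂ (V := W₁ ⊔ W₂) (fun i : Bool => cond i W₁ W₂)
    (fun i => by cases i; exacts [le_sup_right, le_sup_left])
    (fun x hx => hx.elim (fun h => ⟨true, h⟩) (fun h => ⟨false, h⟩))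
    (fun i => match i with | true => b₁ | false => b₂ + secMap S.f W₂ a)
    (by
      rintro (_ | _) (_ | _)
      · rfl
      · have := congrArg (res S.X₂ (inf_comm W₂ W₁).le) hab
        simpa using this.symm
      · exact hab
      · rfl)
  refine ⟨b, sec_ext _ fun x hx => ?_, hb true⟩
  rcases hx with hx | hx
  · refine ⟨W₁, hx, le_sup_left, ?_⟩
    rw [← secMap_res]
    erw [hb true]
    simp [hb₁]
  · refine ⟨W₂, hx, le_sup_right, ?_⟩
    rw [← secMap_res]
    erw [hb false]
    have : secMap S.g W₂ (secMap S.f W₂ a) = 0 := by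
      rw [← secMap_comp, S.zero, secMap_zero]
    simp [hb₂, this]

/-- A lift of a section `c` of the quotient to the part of a box lying over an open subset `V`. -/
structure PartialLift {S : ShortComplex (Sh k (Half M 0))} {U : Opens (M × ℝ)} {a b : ℝ}
    (c : Sec S.X₃ (box U a b)) {α β : ℝ} (hα : a ≤ α) (hβ : β ≤ b) where
  /-- The domain in `M × ℝ` of the lift. -/
  V : Opens (M × ℝ)
  le : V ≤ U
  /-- The lift. -/
  s : Sec S.X₂ (box V α β)
  eq : secMap S.g _ s = res _ (box_mono le hα hβ) c

variable {S : ShortComplex (Sh k (Half M 0))} (hS : S.ShortExact) (hA : BoxFlabby S.X₁)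
include hS hA

/-- A section of the quotient on a box lifts on a box with a smaller range of values of `t + v`
around a given fiber of the projection. This is proved by induction along the compact interval
`[α, β]`: local lifts around the points of the fiber are glued from the bottom to the top. -/
lemma exists_lift_near_fiber {U : Opens (M × ℝ)} {a b : ℝ} (c : Sec S.X₃ (box U a b))
    {y : M × ℝ} (hy : y ∈ U) {α β : ℝ} (hα : a < α) (hβ : β < b) :
    ∃ (V : Opens (M × ℝ)) (_ : y ∈ V) (h : box V α β ≤ box U a b) (s : Sec S.X₂ (box V α β)),
      secMap S.g _ s = res _ h c := by
  have := hS.epi_g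
  let P (γ : ℝ) : Prop := ∃ (V : Opens (M × ℝ)) (_ : y ∈ V) (h : box V α γ ≤ box U a b)
    (s : Sec S.X₂ (box V α γ)), secMap S.g _ s = res _ h c
  have hmono : ∀ γ γ', γ' ≤ γ → P γ → P γ' := by
    rintro γ γ' hγ ⟨V, hV, h, s, hs⟩
    have h' : box V α γ' ≤ box V α γ := box_mono le_rfl le_rfl hγ
    exact ⟨V, hV, h'.trans h, res _ h' s, by rw [secMap_res, hs, res_res]⟩
  have hloc : ∀ w ∈ Set.Icc α β, ∃ (V : Opens (M × ℝ)) (_ : y ∈ V) (ε : ℝ) (_ : 0 < ε)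
      (h : box V (w - ε) (w + ε) ≤ box U a b) (s : Sec S.X₂ (box V (w - ε) (w + ε))),
      secMap S.g _ s = res _ h c := by
    intro w hw
    rcases le_or_gt y.2 w with hyw | hyw
    · let z : Half M 0 := ⟨(y, w - y.2), sub_nonneg.2 hyw⟩
      have e : z.1.1.2 + z.1.2 = w := add_sub_cancel _ _
      have hz : z ∈ box U a b := ⟨hy, by rw [e]; linarith [hw.1], by rw [e]; linarith [hw.2]⟩
      obtain ⟨W, hzW, hW, s, hs⟩ := exists_local_lift S.g c hz
      obtain ⟨V, hV, ε, hε, h⟩ := exists_box_le hzW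
      rw [e] at h
      exact ⟨V, hV, ε, hε, h.trans hW, res _ h s, by rw [secMap_res, hs, res_res]⟩
    · obtain ⟨V, hV, ε, hε, h⟩ := exists_box_eq_bot hyw
      exact ⟨V, hV, ε, hε, h.le.trans bot_le, 0, sec_eq_of_eq_bot _ h _ _⟩
  have hstep : ∀ w ∈ Set.Icc α β, ∃ ε, 0 < ε ∧ ∀ γ, w - ε < γ → P γ → P (w + ε) := by
    intro w hw
    obtain ⟨V₂, hV₂, ε, hε, h₂, s₂, hs₂⟩ := hloc w hw
    refine ⟨ε, hε, ?_⟩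
    rintro γ hγ ⟨V₁, hV₁, h₁, s₁, hs₁⟩
    obtain ⟨s, hs, -⟩ := exists_lift_sup hS c h₁ h₂ s₁ s₂ hs₁ hs₂
      (hA.surjective _ rfl (box_inf _ _ _ _ _ _) inf_le_right (le_max_right _ _)
        (min_le_right _ _))
    have h : box (V₁ ⊓ V₂) α (w + ε) ≤ box V₁ α γ ⊔ box V₂ (w - ε) (w + ε) := by
      rintro q ⟨hq, hq₁, hq₂⟩
      rcases lt_or_ge (q.1.1.2 + q.1.2) γ with h | h
      · exact Or.inl ⟨hq.1, hq₁, h⟩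
      · exact Or.inr ⟨hq.2, hγ.trans_le h, hq₂⟩
    exact ⟨V₁ ⊓ V₂, ⟨hV₁, hV₂⟩, h.trans (sup_le h₁ h₂), res _ h s,
      by rw [secMap_res, hs, res_res]⟩
  rcases lt_or_ge β α with hβα | hαβ
  · have h := box_eq_bot U hβα.le
    exact ⟨U, hy, h.le.trans bot_le, 0, sec_eq_of_eq_bot _ h _ _⟩
  have hmem : β ∈ Set.Icc α β := ⟨hαβ, le_rfl⟩
  suffices Set.Icc α β ⊆ {γ | P γ} from this hmem
  refine IsClosed.Icc_subset_of_forall_exists_gt ?_ ?_ ?_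
  · refine isClosed_of_closure_subset fun γ hγ => ?_
    have hγ' : γ ∈ Set.Icc α β :=
      closure_minimal Set.inter_subset_right isClosed_Icc hγ
    obtain ⟨ε, hε, h⟩ := hstep γ hγ'
    obtain ⟨δ, hδ, hd⟩ := Metric.mem_closure_iff.1 hγ ε hε
    refine ⟨hmono _ _ (by linarith) (h δ ?_ hδ.1), hγ'⟩
    rw [Real.dist_eq, abs_lt] at hd
    linarith [hd.2]
  · have h := box_eq_bot U (le_refl α)
    exact ⟨U, hy, h.le.trans bot_le, 0, sec_eq_of_eq_bot _ h _ _⟩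
  · rintro x ⟨hx, hx'⟩ z hz
    obtain ⟨ε, hε, h⟩ := hstep x ⟨hx'.1, hx'.2.le⟩
    refine ⟨min z (x + ε), hmono _ _ (min_le_right _ _) (h x (by linarith) hx), ?_, min_le_left _ _⟩
    exact lt_min hz (by linarith)

/-- A section of the quotient on a box lifts on boxes over the same open subset whose range of
values of `t + v` is smaller. By Zorn's lemma there is a maximal partial lift, and a lift around
a fiber outside its domain would extend it. -/
lemma exists_lift_of_lt {U : Opens (M × ℝ)} {a b : ℝ} (c : Sec S.X₃ (box U a b))
    {α β : ℝ} (hα : a < α) (hβ : β < b) :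
    ∃ s : Sec S.X₂ (box U α β), secMap S.g _ s = res _ (box_mono le_rfl hα.le hβ.le) c := by
  let r (p q : PartialLift c hα.le hβ.le) : Prop :=
    ∃ h : p.V ≤ q.V, res _ (box_mono h le_rfl le_rfl) q.s = p.s
  obtain ⟨m, hm⟩ : ∃ m, ∀ p, r m p → r p m := by
    refine exists_maximal_of_chains_bounded (r := r) (fun C hC => ?_) ?_
    · have hrefl (p q : C) : r p.1 q.1 ∨ r q.1 p.1 := by
        by_cases hpq : p = q
        · exact Or.inl ⟨hpq ▸ le_rfl, by subst hpq; exact res_self _ _ _⟩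
        · exact hC p.2 q.2 (fun h => hpq (Subtype.ext h))
      obtain ⟨s, hs⟩ := exists_glue_of_total S.X₂ (fun p : C => p.1.V) (fun p => p.1.s) hrefl
      have hU : (⨆ p : C, p.1.V) ≤ U := iSup_le fun p => p.1.le
      suffices hsc : secMap S.g _ s = res _ (box_mono hU hα.le hβ.le) c from
        ⟨⟨⨆ p : C, p.1.V, hU, s, hsc⟩,
          fun p hp => ⟨le_iSup (fun p : C => p.1.V) (⟨p, hp⟩ : C), hs (⟨p, hp⟩ : C)⟩⟩
      refine sec_ext _ fun x hx => ?_
      obtain ⟨p, hp⟩ := Opens.mem_iSup.1 hx.1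
      have hle : box p.1.V α β ≤ box (⨆ p : C, p.1.V) α β :=
        box_mono (le_iSup (fun p : C => p.1.V) p) le_rfl le_rfl
      refine ⟨box p.1.V α β, ⟨hp, hx.2⟩, hle, ?_⟩
      rw [← secMap_res, hs, p.1.eq, res_res]
    · rintro p q t ⟨h, e⟩ ⟨h', e'⟩
      exact ⟨h.trans h', by rw [← e, ← e', res_res]⟩
  obtain ⟨V, hV, s, hs⟩ := m
  obtain rfl : V = U := by
    refine le_antisymm hV fun y hy => ?_
    obtain ⟨V', hV', h', s', hs'⟩ := exists_lift_near_fiber hS hA c hy hα hβ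
    have hle : box (V' ⊓ U) α β ≤ box V' α β := box_mono inf_le_left le_rfl le_rfl
    obtain ⟨s'', hs'', e⟩ := exists_lift_sup hS c (box_mono hV hα.le hβ.le) (hle.trans h') s
      (res _ hle s') hs (by rw [secMap_res, hs', res_res])
      (hA.surjective _ rfl (box_inf _ _ _ _ _ _) inf_le_right (le_max_right _ _)
        (min_le_right _ _))
    have hsup : box (V ⊔ V' ⊓ U) α β ≤ box V α β ⊔ box (V' ⊓ U) α β := by
      rintro q ⟨hq | hq, hq'⟩
      exacts [Or.inl ⟨hq, hq'⟩, Or.inr ⟨hq, hq'⟩]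
    obtain ⟨h, -⟩ := hm ⟨V ⊔ V' ⊓ U, sup_le hV inf_le_right, res _ hsup s'', by
      rw [secMap_res, hs'', res_res]⟩ ⟨le_sup_left, (res_res _ _ _ _).trans e⟩
    exact h (Or.inr ⟨hV', hy⟩)
  exact ⟨s, hs⟩

/-- Taking sections on boxes is exact on short exact sequences whose kernel is box flabby. -/
lemma exists_lift_box {U : Opens (M × ℝ)} {a b : ℝ} (c : Sec S.X₃ (box U a b)) :
    ∃ s : Sec S.X₂ (box U a b), secMap S.g _ s = c := by
  rcases le_or_gt b a with hab | hab
  · exact ⟨0, sec_eq_of_eq_bot _ (box_eq_bot U hab) _ _⟩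
  -- Exhaustion of `]a, b[` by smaller intervals.
  let δ (n : ℕ) : ℝ := (b - a) / (n + 1)
  have hδ : ∀ n, 0 < δ n := fun n => div_pos (sub_pos.2 hab) (by positivity)
  have hδ' : Antitone δ := fun m n h =>
    div_le_div_of_nonneg_left (sub_pos.2 hab).le (by positivity) (by gcongr)
  let B (n : ℕ) : Opens (Half M 0) := box U (a + δ n) (b - δ n)
  have hB : ∀ n, B n ≤ box U a b := fun n =>
    box_mono le_rfl (by linarith [hδ n]) (by linarith [hδ n])
  have hBB : ∀ m n, m ≤ n → B m ≤ B n := fun m n h =>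
    box_mono le_rfl (by linarith [hδ' h]) (by linarith [hδ' h])
  have hcov : ∀ x ∈ box U a b, ∃ n, x ∈ B n := by
    rintro x ⟨hx, hx₁, hx₂⟩
    obtain ⟨n, hn⟩ := exists_nat_gt ((b - a) / min (x.1.1.2 + x.1.2 - a) (b - (x.1.1.2 + x.1.2)))
    have hmin : 0 < min (x.1.1.2 + x.1.2 - a) (b - (x.1.1.2 + x.1.2)) :=
      lt_min (sub_pos.2 hx₁) (sub_pos.2 hx₂)
    have h : δ n < min (x.1.1.2 + x.1.2 - a) (b - (x.1.1.2 + x.1.2)) := by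
      rw [div_lt_iff₀ hmin] at hn
      rw [div_lt_iff₀ (by positivity)]
      nlinarith
    exact ⟨n, hx, by linarith [h.trans_le (min_le_left _ _)],
      by linarith [h.trans_le (min_le_right _ _)]⟩
  let T (n : ℕ) := {s : Sec S.X₂ (B n) // secMap S.g _ s = res _ (hB n) c}
  have hT : ∀ n, Nonempty (T n) := fun n => by
    obtain ⟨s, hs⟩ := exists_lift_of_lt hS hA c (α := a + δ n) (β := b - δ n)
      (by linarith [hδ n]) (by linarith [hδ n])
    exact ⟨⟨s, hs⟩⟩
  -- The lifts on the exhaustion can be chosen compatibly, by correcting them one after the other.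
  have hnext : ∀ n (s : T n), ∃ s' : T (n + 1), res _ (hBB n _ n.le_succ) s'.1 = s.1 := by
    intro n s
    obtain ⟨s', hs'⟩ := (hT (n + 1)).some
    obtain ⟨t, ht, e⟩ := exists_lift_sup hS c (hB n) (hB (n + 1)) s.1 s' s.2 hs'
      (hA.surjective _ rfl (box_inf _ _ _ _ _ _) inf_le_right (le_max_right _ _)
        (min_le_right _ _))
    exact ⟨⟨res _ le_sup_right t, by rw [secMap_res, ht, res_res]⟩, by rw [← e]; simp⟩
  choose next hnext using hnext
  let seq (n : ℕ) : T n := Nat.rec (hT 0).some next n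
  have hseq : ∀ m n (h : m ≤ n), res _ (hBB m n h) (seq n).1 = (seq m).1 := by
    intro m n h
    induction n, h using Nat.le_induction with
    | base => simp
    | succ n h ih => rw [← ih, ← hnext n (seq n), res_res]
  obtain ⟨s, hs⟩ := sec_glue S.X₂ B hB hcov (fun n => (seq n).1) (fun m n => by
    rw [← hseq m _ (le_max_left m n), ← hseq n _ (le_max_right m n), res_res, res_res])
  refine ⟨s, sec_ext _ fun x hx => ?_⟩
  obtain ⟨n, hn⟩ := hcov x hx
  exact ⟨_, hn, hB n, by rw [← secMap_res, hs, (seq n).2]⟩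

lemma BoxFlabby.of_shortExact (hB : BoxFlabby S.X₂) : BoxFlabby S.X₃ := by
  intro U U' a b a' b' hU ha hb c
  obtain ⟨s, rfl⟩ := exists_lift_box hS hA c
  obtain ⟨s, rfl⟩ := hB hU ha hb s
  exact ⟨secMap S.g _ s, (secMap_res _ _ _).symm⟩

end Exact

end Boxes

/-! ### Sections on boxes of inverse images -/

section BoxSections

variable {k : Type u} [CommRing k] {M : Type u} [TopologicalSpace M]

/-- The open subset `{t < b}` of `M × ℝ`. As `v ≥ 0`, it is the projection of the part of
`{((x, t), v) ; 0 ≤ v}` where `t + v < b`. -/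
def below (M : Type u) [TopologicalSpace M] (b : ℝ) : Opens (M × ℝ) :=
  ⟨{y | y.2 < b}, isOpen_lt continuous_snd continuous_const⟩

lemma box_le_map_proj (U : Opens (M × ℝ)) (a b : ℝ) :
    box U a b ≤ (Opens.map (Half.proj M 0)).obj (U ⊓ below M b) :=
  fun q h => ⟨h.1, lt_of_le_of_lt (le_add_of_nonneg_right q.2) h.2.2⟩

variable (F : Sh k (TopCat.of (M × ℝ)))

/-- The pullback of a section of `F` to a box. The section has to be defined on the projection
`U ⊓ below M b` of the box. -/
def pullBox {V U : Opens (M × ℝ)} {a b : ℝ} (hV : U ⊓ below M b ≤ V) :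
    Sec F V →ₗ[k] Sec ((inverse k (Half.proj M 0)).obj F) (box U a b) :=
  (res _ ((box_le_map_proj U a b).trans ((Opens.map (Half.proj M 0)).map (homOfLE hV)).le)) ∘ₗ
    pullSec (Half.proj M 0) F V

lemma pullBox_apply {V U : Opens (M × ℝ)} {a b : ℝ} (hV : U ⊓ below M b ≤ V) (s : Sec F V) :
    pullBox F (a := a) hV s = res _ ((box_le_map_proj U a b).trans
      ((Opens.map (Half.proj M 0)).map (homOfLE hV)).le) (pullSec (Half.proj M 0) F V s) := rfl

lemma res_pullBox {V U U' : Opens (M × ℝ)} {a b a' b' : ℝ} (hV : U ⊓ below M b ≤ V)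
    (h : U' ⊓ below M b' ≤ V) (h' : box U' a' b' ≤ box U a b) (s : Sec F V) :
    res _ h' (pullBox F hV s) = pullBox F (a := a') h s := by
  rw [pullBox_apply, pullBox_apply, res_res]

lemma pullBox_res {V V' U : Opens (M × ℝ)} {a b : ℝ} (hV : U ⊓ below M b ≤ V) (h : V ≤ V')
    (s : Sec F V') : pullBox F (a := a) hV (res F h s) = pullBox F (hV.trans h) s := by
  rw [pullBox_apply, pullBox_apply, pullSec_res, res_res]

/-- The point of `{((x, t), v) ; 0 ≤ v}` such that `(x, t) = y` and `t + v = w`. -/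
def Half.mk (y : M × ℝ) (w : ℝ) (h : y.2 ≤ w) : Half M 0 := ⟨(y, w - y.2), sub_nonneg.2 h⟩

lemma Half.mk_mem_box {y : M × ℝ} {w : ℝ} {h : y.2 ≤ w} {U : Opens (M × ℝ)} {a b : ℝ} :
    Half.mk y w h ∈ box U a b ↔ y ∈ U ∧ w ∈ Set.Ioo a b := by
  rw [mem_box]
  change y ∈ U ∧ a < y.2 + (w - y.2) ∧ y.2 + (w - y.2) < b ↔ _
  rw [add_sub_cancel]
  rfl

lemma Half.mk_self (z : Half M 0) :
    Half.mk z.1.1 (z.1.1.2 + z.1.2) (le_add_of_nonneg_right z.2) = z := by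
  refine Subtype.ext (Prod.ext rfl ?_)
  exact add_sub_cancel_left _ _

/-- If the pullbacks to a box of two sections agree, then the sections agree. -/
lemma pullBox_injective {U : Opens (M × ℝ)} {a b : ℝ} (hab : a < b) (hU : U ≤ below M b) :
    Function.Injective (pullBox F (U := U) (a := a) (b := b) inf_le_left) := by
  intro s s' h
  refine sec_ext F fun y hy => ?_
  have hyb : y.2 < b := hU hy
  obtain ⟨w, hw, hw'⟩ := exists_between (max_lt hab hyb)
  obtain ⟨W, hyW, h₁, h₂, e⟩ := exists_res_eq_of_pullSec_eq (Half.proj M 0) F s s' _ _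
    (Half.mk_mem_box.2 ⟨hy, (le_max_left _ _).trans_lt hw, hw'⟩ :
      Half.mk y w ((le_max_right _ _).trans hw.le) ∈ box U a b) h
  exact ⟨W, hyW, h₁, e⟩

/-- Sections of `p⁻¹ F` agree along connected fibers of `p`: if such a section is the pullback of
a given section of `F` near some point of the fiber of a box at `y`, then this holds near all points
of this fiber. -/
lemma pullBox_eq_near_fiber {U : Opens (M × ℝ)} {a b : ℝ}
    (s : Sec ((inverse k (Half.proj M 0)).obj F) (box U a b)) (i : Sec F U) {y : M × ℝ}
    {w w' : ℝ} (hw : y.2 ≤ w) (hw' : y.2 ≤ w')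
    (hmem : Half.mk y w hw ∈ box U a b) (hmem' : Half.mk y w' hw' ∈ box U a b)
    (h : germ _ hmem s = germ _ hmem (pullBox F inf_le_left i)) :
    germ _ hmem' s = germ _ hmem' (pullBox F inf_le_left i) := by
  let E (w : ℝ) : Prop := ∃ (hw : y.2 ≤ w) (hmem : Half.mk y w hw ∈ box U a b),
    germ _ hmem s = germ _ hmem (pullBox F inf_le_left i)
  have hI : IsPreconnected (Set.Ioo a b ∩ Set.Ici y.2) :=
    (Set.ordConnected_Ioo.inter Set.ordConnected_Ici).isPreconnected
  have hy : y ∈ U := hmem.1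
  suffices H : ∀ w ∈ Set.Ioo a b ∩ Set.Ici y.2, ∀ w' ∈ Set.Ioo a b ∩ Set.Ici y.2,
      (E w ↔ E w') by
    obtain ⟨_, _, e⟩ := (H w ⟨(Half.mk_mem_box.1 hmem).2, hw⟩ w'
      ⟨(Half.mk_mem_box.1 hmem').2, hw'⟩).1 ⟨hw, hmem, h⟩
    exact e
  intro w hw w' hw'
  refine hI.induction₂ (fun w w' => E w ↔ E w') (fun w hw => ?_) (fun _ _ _ _ _ _ => Iff.trans)
    (fun _ _ _ _ => Iff.symm) hw hw'
  have hm : Half.mk y w hw.2 ∈ box U a b := Half.mk_mem_box.2 ⟨hy, hw.1⟩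
  obtain ⟨V, hyV, j, W, hW, hWU, hWV, e⟩ := exists_pullSec_eq (Half.proj M 0) F s hm
  obtain ⟨V', hyV', ε, hε, hV'⟩ := exists_box_le hW
  have hyV : y ∈ V := hyV
  have hyV' : y ∈ V' := hyV'
  -- Near `w`, the condition does not depend on `w`: it is an equality of germs at `y`.
  have key : ∀ v ∈ Set.Ioo a b ∩ Set.Ici y.2, v ∈ Set.Ioo (w - ε) (w + ε) →
      (E v ↔ germ F hyV j = germ F hy i) := by
    intro v hv hvε
    have hvm : Half.mk y v hv.2 ∈ box U a b := Half.mk_mem_box.2 ⟨hy, hv.1⟩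
    have hvW : Half.mk y v hv.2 ∈ W := hV' (Half.mk_mem_box.2 ⟨hyV', by
      have : (Half.mk y w hw.2).1.1.2 + (Half.mk y w hw.2).1.2 = w := add_sub_cancel _ _
      rwa [this]⟩)
    have e1 : germ _ hvm s = germ (x := Half.mk y v hv.2) _ (hWV hvW)
        (pullSec (Half.proj M 0) F V j) :=
      (germ_eq_iff _ _ _ _ _).2 ⟨W, hvW, hWU, hWV, e⟩
    have e2 : germ _ hvm (pullBox F inf_le_left i) =
        germ (U := (Opens.map (Half.proj M 0)).obj U) (x := Half.mk y v hv.2) _ hy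
          (pullSec (Half.proj M 0) F U i) :=
      (germ_eq_iff _ _ _ _ _).2 ⟨_, hvm, le_rfl,
        (box_le_map_proj U a b).trans ((Opens.map (Half.proj M 0)).map (homOfLE inf_le_left)).le, by
          rw [pullBox_apply, res_res]⟩
    have e3 := inverseStalkHom_germ (Half.proj M 0) F (x := Half.mk y v hv.2) hyV j
    have e4 := inverseStalkHom_germ (Half.proj M 0) F (x := Half.mk y v hv.2) hy i
    have inj : Function.Injective (inverseStalkHom k (Half.proj M 0) F (Half.mk y v hv.2)).hom :=
      (ModuleCat.mono_iff_injective (inverseStalkHom k (Half.proj M 0) F (Half.mk y v hv.2))).1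
        inferInstance
    constructor
    · rintro ⟨_, _, h⟩
      exact inj (e3.trans (e1.symm.trans (h.trans (e2.trans e4.symm))))
    · intro h
      refine ⟨hv.2, hvm, e1.trans (e3.symm.trans (Eq.trans ?_ (e4.trans e2.symm)))⟩
      exact congrArg _ h
  have h1 := key w hw ⟨by linarith, by linarith⟩
  filter_upwards [self_mem_nhdsWithin, mem_nhdsWithin_of_mem_nhds
    (Ioo_mem_nhds (show w - ε < w by linarith) (show w < w + ε by linarith))] with v hv hv'
  exact h1.trans (key v hv hv').symm

/-- Every section of `p⁻¹ F` on a box is the pullback of a section of `F`. -/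
lemma pullBox_surjective {U : Opens (M × ℝ)} {a b : ℝ} (hab : a < b) :
    Function.Surjective (pullBox F (U := U) (a := a) (b := b) le_rfl) := by
  intro s
  have hloc : ∀ y ∈ U ⊓ below M b, ∃ (V : Opens (M × ℝ)) (_ : y ∈ V) (hV : V ≤ U ⊓ below M b)
      (i : Sec F V), res _ (box_mono (hV.trans inf_le_left) le_rfl le_rfl) s =
        pullBox F (U := V) (a := a) (b := b) inf_le_left i := by
    intro y hy
    have hyb : y.2 < b := hy.2
    obtain ⟨w, hw, hw'⟩ := exists_between (max_lt hab hyb)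
    have hyw : y.2 ≤ w := (le_max_right _ _).trans hw.le
    have hm : Half.mk y w hyw ∈ box U a b :=
      Half.mk_mem_box.2 ⟨hy.1, (le_max_left _ _).trans_lt hw, hw'⟩
    obtain ⟨V, hyV, i, W, hmW, hWU, hWV, e⟩ := exists_pullSec_eq (Half.proj M 0) F s hm
    obtain ⟨V', hyV', ε, hε, hV'⟩ := exists_box_le hmW
    have hwε : (Half.mk y w hyw).1.1.2 + (Half.mk y w hyw).1.2 = w := add_sub_cancel _ _
    rw [hwε] at hV'
    -- The fibers over `N` meet the neighborhood of `(y, w)` where `s` is the pullback of `i`.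
    let N : Opens (M × ℝ) := V ⊓ V' ⊓ (U ⊓ below M b) ⊓ below M (w + ε)
    have hNV : N ≤ V := inf_le_left.trans (inf_le_left.trans inf_le_left)
    have hNU : N ≤ U ⊓ below M b := inf_le_left.trans inf_le_right
    have hyε : y.2 < w + ε := by linarith
    refine ⟨N, ⟨⟨⟨hyV, hyV'⟩, hy⟩, hyε⟩, hNU, res _ hNV i, sec_ext _ fun z hz => ?_⟩
    have hzN : z.1.1 ∈ N := hz.1
    obtain ⟨v, hv, hv'⟩ : ∃ v, max (max a (w - ε)) z.1.1.2 ≤ v ∧ v < min b (w + ε) ∧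
        a < v ∧ w - ε < v := by
      have h1 : a < b := hab
      have h2 : z.1.1.2 < b := hzN.1.2.2
      have h3 : z.1.1.2 < w + ε := hzN.2
      have h4 : a < w := (le_max_left _ _).trans_lt hw
      obtain ⟨v, hv, hv'⟩ := exists_between (show max (max a (w - ε)) z.1.1.2 < min b (w + ε) from
        max_lt (max_lt (lt_min hab (by linarith)) (lt_min (by linarith) (by linarith)))
          (lt_min h2 h3))
      exact ⟨v, hv.le, hv', (le_max_left _ _).trans_lt ((le_max_left _ _).trans_lt hv),
        (le_max_right _ _).trans_lt ((le_max_left _ _).trans_lt hv)⟩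
    have hzv : z.1.1.2 ≤ v := (le_max_right _ _).trans hv
    have hmem : Half.mk z.1.1 v hzv ∈ box N a b :=
      Half.mk_mem_box.2 ⟨hzN, hv'.2.1, hv'.1.trans_le (min_le_left _ _)⟩
    have hmem' : Half.mk z.1.1 (z.1.1.2 + z.1.2) (le_add_of_nonneg_right z.2) ∈ box N a b := by
      rw [Half.mk_self]; exact hz
    have hvW : Half.mk z.1.1 v hzv ∈ W := hV' (Half.mk_mem_box.2
      ⟨hzN.1.1.2, hv'.2.2, hv'.1.trans_le (min_le_right _ _)⟩)
    have := pullBox_eq_near_fiber F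
      (res _ (box_mono (hNU.trans inf_le_left) le_rfl le_rfl) s) (res _ hNV i) hzv
      (le_add_of_nonneg_right z.2) hmem hmem' (by
        rw [germ_eq_iff]
        refine ⟨W ⊓ box N a b, ⟨hvW, hmem⟩, inf_le_right, inf_le_right, ?_⟩
        have := congrArg (res _ (inf_le_left : W ⊓ box N a b ≤ W)) e
        rw [pullBox_apply, pullSec_res]
        simpa using this)
    obtain ⟨O, hO, h1, h2, e⟩ := (germ_eq_iff _ _ _ _ _).1 this
    rw [Half.mk_self] at hO
    exact ⟨O, hO, h1, e⟩
  choose V hyV hV i hi using hloc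
  obtain ⟨t, ht⟩ := sec_glue F (fun y : (U ⊓ below M b : Opens (M × ℝ)) => V y.1 y.2)
    (fun y => hV y.1 y.2) (fun y hy => ⟨⟨y, hy⟩, hyV y hy⟩) (fun y => i y.1 y.2) (fun y y' => by
      apply pullBox_injective F hab (inf_le_left.trans ((hV y.1 y.2).trans inf_le_right))
      have h1 := congrArg (res _ (box_mono (inf_le_left : V y.1 y.2 ⊓ V y'.1 y'.2 ≤ _)
        (le_refl a) (le_refl b))) (hi y.1 y.2)
      have h2 := congrArg (res _ (box_mono (inf_le_right : V y.1 y.2 ⊓ V y'.1 y'.2 ≤ _)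
        (le_refl a) (le_refl b))) (hi y'.1 y'.2)
      rw [res_res, res_pullBox F _ (inf_le_left.trans inf_le_left)] at h1
      rw [res_res, res_pullBox F _ (inf_le_left.trans inf_le_right)] at h2
      rw [pullBox_res, pullBox_res, ← h1, ← h2])
  refine ⟨t, sec_ext _ fun z hz => ?_⟩
  have hz' : z.1.1 ∈ U ⊓ below M b := box_le_map_proj U a b hz
  refine ⟨box (V _ hz') a b, ⟨hyV _ hz', hz.2⟩,
    box_mono ((hV _ hz').trans inf_le_left) le_rfl le_rfl, ?_⟩
  rw [hi, res_pullBox F _ (inf_le_left.trans (hV _ hz')), ← ht ⟨_, hz'⟩, pullBox_res]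

/-- The inverse image of an injective sheaf `F` is box flabby, since its sections on boxes are
sections of `F`, and these extend. -/
lemma boxFlabby_inverse_of_injective [Injective F] :
    BoxFlabby ((inverse k (Half.proj M 0)).obj F) := by
  intro U U' a b a' b' hU ha hb s
  rcases le_or_gt b' a' with hab | hab
  · exact ⟨0, sec_eq_of_eq_bot _ (box_eq_bot U' hab) _ _⟩
  obtain ⟨i, rfl⟩ := pullBox_surjective F hab s
  have h : U' ⊓ below M b' ≤ U ⊓ below M b :=
    inf_le_inf hU fun y (hy : y.2 < b') => hy.trans_le hb
  obtain ⟨i, rfl⟩ := res_surjective_of_injective F h i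
  exact ⟨pullBox F le_rfl i, by rw [res_pullBox F _ h, pullBox_res]⟩

end BoxSections

/-! ### Acyclicity for the direct image by the sum -/

section Acyclic

/-- The short exact sequence `0 ⟶ Z^l ⟶ K^l ⟶ Z^m ⟶ 0` of cocycles of an acyclic complex. -/
lemma shortExact_kernel_lift {A : Type*} [Category* A] [Abelian A] (K : CochainComplex A ℤ)
    (hK : K.Acyclic) (l m n : ℤ) (h : l + 1 = m) (h' : m + 1 = n) :
    (ShortComplex.mk (kernel.ι (K.d l m)) (kernel.lift (K.d m n) (K.d l m) (K.d_comp_d _ _ _))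
      (by rw [← cancel_mono (kernel.ι _)]; simp)).ShortExact := by
  have hepi : Epi (kernel.lift (K.d m n) (K.d l m) (K.d_comp_d _ _ _)) := by
    have h₁ := hK m
    rw [K.exactAt_iff' l m n (by simp; lia) (by simp; lia)] at h₁
    exact (ShortComplex.exact_iff_epi_kernel_lift _).1 h₁
  exact
    { mono_f := inferInstance
      epi_g := hepi
      exact := ShortComplex.exact_of_f_is_kernel _ (isKernelOfComp (kernel.ι (K.d m n)) (K.d l m)
        (kernelIsKernel _) _ (kernel.lift_ι _ _ _)) }

variable {k : Type u} [CommRing k] {M : Type u} [TopologicalSpace M]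

lemma boxFlabby_of_isZero {F : Sh k (Half M 0)} (hF : IsZero F) : BoxFlabby F := by
  have : Injective F := Injective.of_iso hF.isoZero.symm inferInstance
  exact boxFlabby_of_injective F

lemma BoxFlabby.of_decomposition {F A B : Sh k (Half M 0)} (hA : BoxFlabby A) (hB : BoxFlabby B)
    (p : F ⟶ A) (i : A ⟶ F) (q : F ⟶ B) (j : B ⟶ F) (h : p ≫ i + q ≫ j = 𝟙 F) :
    BoxFlabby F := by
  intro U U' a b a' b' hU ha hb s
  obtain ⟨x, hx⟩ := hA hU ha hb (secMap p _ s)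
  obtain ⟨y, hy⟩ := hB hU ha hb (secMap q _ s)
  refine ⟨secMap i _ x + secMap j _ y, ?_⟩
  rw [map_add, ← secMap_res, ← secMap_res, hx, hy]
  exact congrArg (fun f => secMap f _ s) h

/-- In a bounded below acyclic complex of box flabby sheaves, the cocycles are box flabby, by
induction on the degree. -/
lemma boxFlabby_kernel_d (K : CochainComplex (Sh k (Half M 0)) ℤ) (n₀ : ℤ) [K.IsStrictlyGE n₀]
    (hK : K.Acyclic) (h : ∀ n, BoxFlabby (K.X n)) (m n : ℤ) (hn : m + 1 = n) :
    BoxFlabby (kernel (K.d m n)) := by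
  have low (m n : ℤ) (hm : m < n₀) : BoxFlabby (kernel (K.d m n)) :=
    boxFlabby_of_isZero (IsZero.of_mono (kernel.ι (K.d m n)) (K.isZero_of_isStrictlyGE n₀ m hm))
  by_cases hm : m < n₀
  · exact low m n hm
  · obtain ⟨p, rfl⟩ : ∃ p : ℕ, m = n₀ - 1 + p := ⟨(m - (n₀ - 1)).toNat, by lia⟩
    clear hm
    induction p generalizing n with
    | zero => exact low _ _ (by simp)
    | succ p ih =>
      exact BoxFlabby.of_shortExact (shortExact_kernel_lift K hK (n₀ - 1 + p) _ _
        (by push_cast; lia) hn) (ih _ (by push_cast; lia)) (h _)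

/-- The open subset `V × ]a, b[` of `M × ℝ`. -/
def prodIoo (V : Opens M) (a b : ℝ) : Opens (TopCat.of (M × ℝ)) :=
  ⟨(V : Set M) ×ˢ Set.Ioo a b, V.isOpen.prod isOpen_Ioo⟩

lemma map_sum_prodIoo (V : Opens M) (a b : ℝ) :
    (Opens.map (Half.sum M 0)).obj (prodIoo V a b) =
      box ⟨(V : Set M) ×ˢ Set.univ, V.isOpen.prod isOpen_univ⟩ a b := by
  ext q
  change (_ ∈ V ∧ _ < _ ∧ _ < _) ↔ ((_ ∈ V ∧ True) ∧ _)
  rw [and_true]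
  rfl

lemma exists_prod_Ioo_le {U : Opens (TopCat.of (M × ℝ))} {x : TopCat.of (M × ℝ)} (hx : x ∈ U) :
    ∃ (V : Opens M) (a b : ℝ) (_ : x.1 ∈ V) (_ : x.2 ∈ Set.Ioo a b),
      prodIoo V a b ≤ U := by
  obtain ⟨V, W, hV, hW, h₁, h₂, h⟩ := isOpen_prod_iff.1 U.isOpen x.1 x.2 hx
  obtain ⟨ε, hε, hb⟩ := Metric.isOpen_iff.1 hW _ h₂
  refine ⟨⟨V, hV⟩, x.2 - ε, x.2 + ε, h₁, ⟨by linarith, by linarith⟩, fun y hy => h ⟨hy.1, hb ?_⟩⟩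
  rw [Real.ball_eq_Ioo]
  exact hy.2

lemma exists_lift_box_of_shortExact {A Z₁ B Z₂ Z₃ C : Sh k (Half M 0)} {i₁ : Z₁ ⟶ A}
    {p₁ : A ⟶ Z₂} {i₂ : Z₂ ⟶ B} {p₂ : B ⟶ Z₃} {w₁ : i₁ ≫ p₁ = 0} {w₂ : i₂ ≫ p₂ = 0}
    (i₃ : Z₃ ⟶ C) [Mono i₃] (h₁ : (ShortComplex.mk i₁ p₁ w₁).ShortExact)
    (h₂ : (ShortComplex.mk i₂ p₂ w₂).ShortExact) (hZ : BoxFlabby Z₁)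
    {U : Opens (M × ℝ)} {a b : ℝ}
    (s : Sec B (box U a b)) (hs : secMap (p₂ ≫ i₃) _ s = 0) :
    ∃ t : Sec A (box U a b), secMap (p₁ ≫ i₂) _ t = s := by
  have := h₂.mono_f
  have hs' : secMap p₂ (box U a b) s = 0 := secMap_injective i₃ _ (by
    rw [map_zero, ← secMap_comp]
    exact hs)
  obtain ⟨c, rfl⟩ := exists_secMap_eq h₂.exact s hs'
  obtain ⟨t, rfl⟩ := exists_lift_box h₁ hZ c
  exact ⟨t, secMap_comp _ _ _ _⟩

/-- Taking sections on boxes preserves the exactness of bounded below complexes of box flabby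
sheaves. -/
lemma exists_lift_box_of_acyclic (K : CochainComplex (Sh k (Half M 0)) ℤ) (n₀ : ℤ)
    [K.IsStrictlyGE n₀] (hK : K.Acyclic) (h : ∀ n, BoxFlabby (K.X n)) (l m n : ℤ)
    (hl : l + 1 = m) (hm : m + 1 = n) {U : Opens (M × ℝ)} {a b : ℝ}
    (s : Sec (K.X m) (box U a b)) (hs : secMap (K.d m n) _ s = 0) :
    ∃ t : Sec (K.X l) (box U a b), secMap (K.d l m) _ t = s := by
  have := exists_lift_box_of_shortExact (kernel.ι (K.d n (n + 1)))
    (shortExact_kernel_lift K hK l m n hl hm) (shortExact_kernel_lift K hK m n (n + 1) hm rfl)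
    (boxFlabby_kernel_d K n₀ hK h _ _ hl) s
  rw [kernel.lift_ι, kernel.lift_ι] at this
  exact this hs

/-- Exactness on boxes implies local exactness after direct image by the sum, since the inverse
images of the products `V × ]a, b[` by the sum are boxes. -/
lemma exists_lift_map_sum {F G H : Sh k (Half M 0)} (f : F ⟶ G) (g : G ⟶ H)
    (hfg : ∀ (U : Opens (M × ℝ)) (a b : ℝ) (s : Sec G (box U a b)), secMap g _ s = 0 →
      ∃ t : Sec F (box U a b), secMap f _ t = s) {U : Opens (TopCat.of (M × ℝ))}
    (b : Sec ((direct k (Half.sum M 0)).obj G) U)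
    (hb : secMap ((direct k (Half.sum M 0)).map g) U b = 0) {x : TopCat.of (M × ℝ)} (hx : x ∈ U) :
    ∃ (V : Opens (TopCat.of (M × ℝ))) (_ : x ∈ V) (hV : V ≤ U)
      (a : Sec ((direct k (Half.sum M 0)).obj F) V),
      secMap ((direct k (Half.sum M 0)).map f) V a =
        res ((direct k (Half.sum M 0)).obj G) hV b := by
  obtain ⟨V, α, β, hxV, hxab, hU⟩ := exists_prod_Ioo_le hx
  refine ⟨_, Set.mk_mem_prod hxV hxab, hU, ?_⟩
  have hW : box ⟨(V : Set M) ×ˢ Set.univ, V.isOpen.prod isOpen_univ⟩ α β ≤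
      (Opens.map (Half.sum M 0)).obj U := by
    rw [← map_sum_prodIoo]
    exact fun q hq => hU hq
  obtain ⟨a, ha⟩ := hfg _ _ _ (res G hW b) ((secMap_res g hW b).trans
    ((congrArg (res H hW) hb).trans (map_zero _)))
  refine ⟨res F (map_sum_prodIoo V α β).le a, ?_⟩
  exact (secMap_res f (map_sum_prodIoo V α β).le a).trans
    ((congrArg _ ha).trans (res_res G _ _ b))

lemma acyclic_map_sum (K : CochainComplex (Sh k (Half M 0)) ℤ) (n₀ : ℤ) [K.IsStrictlyGE n₀]
    (hK : K.Acyclic) (h : ∀ n, BoxFlabby (K.X n)) :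
    (((direct k (Half.sum M 0)).mapHomologicalComplex (.up ℤ)).obj K).Acyclic := by
  intro n
  rw [HomologicalComplex.exactAt_iff' _ (n - 1) n (n + 1) (by simp) (by simp),
    exact_iff_locally_exact]
  intro U b hb x hx
  exact exists_lift_map_sum (K.d (n - 1) n) (K.d n (n + 1))
    (fun _ _ _ s hs => exists_lift_box_of_acyclic K n₀ hK h _ _ _ (by lia) rfl s hs) b hb hx

lemma quasiIso_map_sum {K L : HomotopyCategory.Plus (Sh k (Half M 0))} (f : K ⟶ L)
    (hf : HomotopyCategory.Plus.quasiIso _ f) (hK : ∀ n, BoxFlabby (K.obj.as.X n))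
    (hL : ∀ n, BoxFlabby (L.obj.as.X n)) :
    HomotopyCategory.Plus.quasiIso _ ((direct k (Half.sum M 0)).mapHomotopyCategoryPlus.map f) := by
  obtain ⟨⟨K, n₁, _⟩, rfl⟩ := HomotopyCategory.Plus.quotient_obj_surjective K
  obtain ⟨⟨L, n₂, _⟩, rfl⟩ := HomotopyCategory.Plus.quotient_obj_surjective L
  obtain ⟨⟨f⟩, rfl⟩ := (HomotopyCategory.Plus.quotient _).map_surjective f
  change K ⟶ L at f
  change ∀ n, BoxFlabby (K.X n) at hK
  change ∀ n, BoxFlabby (L.X n) at hL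
  change HomotopyCategory.quasiIso _ _ ((HomotopyCategory.quotient _ _).map f) at hf
  change HomotopyCategory.quasiIso _ _ (((direct k (Half.sum M 0)).mapHomotopyCategory _).map
    ((HomotopyCategory.quotient _ _).map f))
  rw [HomotopyCategory.quasiIso_eq_trW_subcategoryAcyclic] at hf ⊢
  have hT := HomotopyCategory.mappingCone_triangleh_distinguished f
  have hT' := ((direct k (Half.sum M 0)).mapHomotopyCategory (.up ℤ)).map_distinguished _ hT
  refine (ObjectProperty.trW_iff_of_distinguished _ _ hT').2 ?_
  have hC := (ObjectProperty.trW_iff_of_distinguished _ _ hT).1 hf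
  have hC' := (HomotopyCategory.quotient_obj_mem_subcategoryAcyclic_iff_acyclic _).1 hC
  have : (CochainComplex.mappingCone f).IsStrictlyGE (min (n₁ - 1) n₂) :=
    CochainComplex.isStrictlyGE_mappingCone f n₁ n₂ _ (by simp) (by simp)
  exact (HomotopyCategory.quotient_obj_mem_subcategoryAcyclic_iff_acyclic _).2
    (acyclic_map_sum (CochainComplex.mappingCone f) (min (n₁ - 1) n₂) hC' fun n =>
      (hK (n + 1)).of_decomposition (hL n) _ _ _ _
        (CochainComplex.mappingCone.id_X f n (n + 1) rfl))

/-- The direct image by the sum of a bounded below complex of box flabby sheaves is its derived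
direct image. -/
lemma isIso_unit_sum (K : HomotopyCategory.Plus (Sh k (Half M 0)))
    (hK : ∀ n, BoxFlabby (K.obj.as.X n)) :
    IsIso ((direct k (Half.sum M 0)).rightDerivedFunctorPlusUnit.app K) := by
  obtain ⟨⟨K, n, _⟩, rfl⟩ := HomotopyCategory.Plus.quotient_obj_surjective K
  obtain ⟨L, _, i, hi⟩ := CochainComplex.Plus.exists_quasiIso_injective ⟨K, n, ‹_›⟩ n
  let j := (HomotopyCategory.Plus.quotient _).map i
  have hj : HomotopyCategory.Plus.quasiIso _ j := by
    change HomotopyCategory.quasiIso _ _ ((HomotopyCategory.quotient _ _).map i.hom)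
    exact (HomotopyCategory.quotient_map_mem_quasiIso_iff _).2 hi
  have := Localization.inverts DerivedCategory.Plus.Qh (HomotopyCategory.Plus.quasiIso _) _ hj
  have := Localization.inverts DerivedCategory.Plus.Qh (HomotopyCategory.Plus.quasiIso _) _
    (quasiIso_map_sum j hj hK fun n => by
      have : Injective (((InjectiveObject.ι _).mapCochainComplexPlus.obj L).obj.X n) :=
        inferInstanceAs (Injective ((InjectiveObject.ι _).obj (L.obj.X n)))
      exact boxFlabby_of_injective _)
  have h := (direct k (Half.sum M 0)).rightDerivedFunctorPlusUnit.naturality j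
  have : IsIso (((direct k (Half.sum M 0)).mapHomotopyCategoryPlus ⋙
      DerivedCategory.Plus.Qh).map j) := this
  have : IsIso ((DerivedCategory.Plus.Qh ⋙ directPlus k (Half.sum M 0)).map j) := by
    dsimp; infer_instance
  have : IsIso ((direct k (Half.sum M 0)).rightDerivedFunctorPlusUnit.app
    ((HomotopyCategory.Plus.quotient _).obj ((InjectiveObject.ι _).mapCochainComplexPlus.obj L))) :=
      inferInstance
  exact IsIso.of_isIso_fac_right h.symm

end Acyclic

/-! ### Restriction morphisms between direct images of sheaves -/

section Restriction

variable (k : Type u) [CommRing k] {X Y Z : TopCat.{u}}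

/-- The restriction morphism `f_* ⟶ g_*` for maps such that `g⁻¹ U ⊆ f⁻¹ U` for all opens `U`. -/
def restDirect {f g : X ⟶ Y} (h : ∀ U, (Opens.map g).obj U ≤ (Opens.map f).obj U) :
    direct k f ⟶ direct k g where
  app F := ⟨{ app U := F.obj.map (homOfLE (h U.unop)).op
              naturality U V i := (F.obj.map_comp ((Opens.map f).op.map i)
                (homOfLE (h V.unop)).op).symm.trans
                  (F.obj.map_comp (homOfLE (h U.unop)).op ((Opens.map g).op.map i)) }⟩
  naturality _ _ φ := ObjectProperty.hom_ext _ (NatTrans.ext (funext fun _ =>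
    (φ.hom.naturality _).symm))

variable {k}

lemma restDirect_comp {f g l : X ⟶ Y} (h : ∀ U, (Opens.map g).obj U ≤ (Opens.map f).obj U)
    (h' : ∀ U, (Opens.map l).obj U ≤ (Opens.map g).obj U)
    (h'' : ∀ U, (Opens.map l).obj U ≤ (Opens.map f).obj U) :
    restDirect k h ≫ restDirect k h' = restDirect k h'' := by
  ext F : 2
  refine hom_ext_secMap fun U s => ?_
  rw [NatTrans.comp_app]
  refine (secMap_comp _ _ _ _).trans ?_
  exact res_res F (h U) (h' U) s

lemma secMap_inverseComp (e : X ⟶ Y) (p : Y ⟶ Z) (F : Sh k Z) (U : Opens Z) (s : Sec F U) :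
    secMap ((inverseComp k e p).hom.app F) _ (pullSec e ((inverse k p).obj F) _
      (pullSec p F U s)) = pullSec (e ≫ p) F U s := by
  have h := Adjunction.unit_leftAdjointUniq_hom_app
    ((inverseDirectAdj k p).comp (inverseDirectAdj k e)) (inverseDirectAdj k (e ≫ p)) F
  exact congrArg (fun φ => secMap φ U s) h

lemma secMap_inverseId (F : Sh k X) (U : Opens X) (s : Sec F U) :
    secMap ((inverseId k X).hom.app F) _ (pullSec (𝟙 X) F U s) = s := by
  have h := Adjunction.unit_leftAdjointUniq_hom_app
    (inverseDirectAdj k (𝟙 X)) Adjunction.id F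
  exact congrArg (fun φ => secMap φ U s) h

variable (k)

/-- The morphism of functors `s_* p⁻¹ ⟶ s'_* p'⁻¹` defined by a map `e` over `(p, s)`. -/
def restPullPush {A A' X : TopCat.{u}} {p s : A ⟶ X} {p' s' : A' ⟶ X} (e : A' ⟶ A)
    (hp : e ≫ p = p') (hs : e ≫ s = s') :
    inverse k p ⋙ direct k s ⟶ inverse k p' ⋙ direct k s' :=
  Functor.whiskerLeft (inverse k p) (directUnit k e s) ≫
    Functor.whiskerRight (inverseComp k e p).hom (direct k (e ≫ s)) ≫
    eqToHom (by rw [hp, hs])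

variable {k}

lemma secMap_restPullPush {A A' X : TopCat.{u}} {p s : A ⟶ X} {p' s' : A' ⟶ X} (e : A' ⟶ A)
    (hp : e ≫ p = p') (hs : e ≫ s = s') (F : Sh k X) (U V : Opens X)
    (h : (Opens.map s).obj U ≤ (Opens.map p).obj V)
    (h' : (Opens.map s').obj U ≤ (Opens.map p').obj V) (t : Sec F V) :
    secMap ((restPullPush k e hp hs).app F) U (res ((inverse k p).obj F) h (pullSec p F V t)) =
      res ((inverse k p').obj F) h' (pullSec p' F V t) := by
  subst hp hs
  dsimp only [restPullPush]
  rw [eqToHom_refl, Category.comp_id, NatTrans.comp_app]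
  refine (secMap_comp _ _ _ _).trans ?_
  have h1 : secMap ((Functor.whiskerLeft (inverse k p) (directUnit k e s)).app F) U
      (res ((inverse k p).obj F) h (pullSec p F V t)) =
      res ((inverse k e).obj ((inverse k p).obj F)) ((Opens.map e).map (homOfLE h)).le
        (pullSec e ((inverse k p).obj F) _ (pullSec p F V t)) :=
    pullSec_res e _ h _
  rw [h1]
  refine (secMap_res ((inverseComp k e p).hom.app F) ((Opens.map e).map (homOfLE h)).le _).trans ?_
  rw [secMap_inverseComp]
  rfl

end Restriction

/-! ### The topology of lower sets -/

section Lower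

variable (k : Type u) [CommRing k] (M : Type u) [TopologicalSpace M]

/-- The set `M × ℝ` endowed with the topology given by the open subsets of `M × ℝ` which are lower
sets along `ℝ`. -/
def Lower : Type u := M × ℝ

instance : TopologicalSpace (Lower M) where
  IsOpen U := IsOpen (X := M × ℝ) U ∧ ∀ (x : M) (t t' : ℝ), t' ≤ t →
    ((x, t) : M × ℝ) ∈ (U : Set (M × ℝ)) → ((x, t') : M × ℝ) ∈ (U : Set (M × ℝ))
  isOpen_univ := ⟨isOpen_univ, fun _ _ _ _ _ => trivial⟩
  isOpen_inter _ _ h h' := ⟨h.1.inter h'.1, fun x t t' ht hx =>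
    ⟨h.2 x t t' ht hx.1, h'.2 x t t' ht hx.2⟩⟩
  isOpen_sUnion _ hS := ⟨isOpen_sUnion fun U hU => (hS U hU).1, fun x t t' ht ⟨U, hU, hx⟩ =>
    ⟨U, hU, (hS U hU).2 x t t' ht hx⟩⟩

/-- The continuous identity map from `M × ℝ` to `Lower M`. -/
def toLower : TopCat.of (M × ℝ) ⟶ TopCat.of (Lower M) :=
  TopCat.ofHom (Y := Lower M) ⟨fun p => p, ⟨fun _ h => h.1⟩⟩

/-- The translation `(x, t) ↦ (x, t + c)` of `Lower M`. -/
def Lower.translation (c : ℝ) : TopCat.of (Lower M) ⟶ TopCat.of (Lower M) :=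
  TopCat.ofHom (X := Lower M) (Y := Lower M) ⟨fun p => ((p.1, p.2 + c) : M × ℝ),
    ⟨fun _ h => ⟨h.1.preimage (by fun_prop : Continuous fun p : M × ℝ => (p.1, p.2 + c)),
      fun x t t' ht hx => h.2 x (t + c) (t' + c) (by linarith) hx⟩⟩⟩

lemma toLower_translation (c d : ℝ) :
    Tamarkin.translation M c ≫ toLower M ≫ Lower.translation M d =
      Tamarkin.translation M (c + d) ≫ toLower M := by
  ext p
  exact Prod.ext rfl (add_assoc p.2 c d)

variable {M}

lemma mem_lower {U : Opens (TopCat.of (Lower M))} {x : M} {t t' : ℝ} (ht : t' ≤ t)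
    (h : (x, t) ∈ (Opens.map (toLower M)).obj U) : (x, t') ∈ (Opens.map (toLower M)).obj U :=
  U.isOpen.2 x t t' ht h

lemma map_translation_le {c : ℝ} (hc : 0 ≤ c) (U : Opens (TopCat.of (Lower M))) :
    (Opens.map (Tamarkin.translation M c ≫ toLower M)).obj U ≤ (Opens.map (toLower M)).obj U :=
  fun _ h => mem_lower (le_add_of_nonneg_right hc) h

lemma map_sum_le (U : Opens (TopCat.of (Lower M))) :
    (Opens.map (Half.sum M 0 ≫ toLower M)).obj U ≤
      (Opens.map (Half.proj M 0 ≫ toLower M)).obj U :=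
  fun q h => mem_lower (le_add_of_nonneg_right q.2) h

variable (M)

/-- The restriction morphism `φ_* ⟶ φ_* T_{c*}`, where `φ` is the map `M × ℝ ⟶ Lower M`: for an
open lower set `U`, it restricts sections on `U` to `T_c⁻¹ U ⊆ U`. -/
def lowerRest {c : ℝ} (hc : 0 ≤ c) :
    direct k (toLower M) ⟶ direct k (Tamarkin.translation M c ≫ toLower M) :=
  restDirect k (map_translation_le hc)

/-- The morphism `φ_* ⟶ φ_* s_* p⁻¹` which sends a section on a lower set `U` to the restriction of
its pullback by `p` to `s⁻¹ U ⊆ p⁻¹ U`. -/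
def lowerPull : direct k (toLower M) ⟶
    (inverse k (Half.proj M 0) ⋙ direct k (Half.sum M 0)) ⋙ direct k (toLower M) :=
  directUnit k (Half.proj M 0) (toLower M) ≫
    Functor.whiskerLeft (inverse k (Half.proj M 0)) (restDirect k map_sum_le)

/-- The morphism `s_* p⁻¹ F ⟶ T_{c*} F`, given by the restriction to `{v = c} ⊆ {v ≥ 0}`. -/
def sumRest {c : ℝ} (hc : 0 ≤ c) :
    inverse k (Half.proj M 0) ⋙ direct k (Half.sum M 0) ⟶ direct k (Tamarkin.translation M c) :=
  restPullPush k (p' := Half.proj M c) (s' := Half.sum M c) (Half.incl M hc) rfl rfl ≫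
    restPullPush k (p' := 𝟙 _) (s' := Tamarkin.translation M c) (Half.edge M c) rfl rfl ≫
    Functor.whiskerRight (inverseId k _).hom _ ≫ (Functor.leftUnitor _).hom

variable {k M}

lemma secMap_sumRest {c : ℝ} (hc : 0 ≤ c) (F : Sh k (TopCat.of (M × ℝ)))
    (U V : Opens (TopCat.of (M × ℝ)))
    (h : (Opens.map (Half.sum M 0)).obj U ≤ (Opens.map (Half.proj M 0)).obj V)
    (h' : (Opens.map (Tamarkin.translation M c)).obj U ≤ V) (t : Sec F V) :
    secMap ((sumRest k M hc).app F) U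
      (res ((inverse k (Half.proj M 0)).obj F) h (pullSec (Half.proj M 0) F V t)) =
        res F h' t := by
  have h₁ : (Opens.map (Half.sum M c)).obj U ≤ (Opens.map (Half.proj M c)).obj V :=
    fun q hq => @h (⟨q.1, hc.trans q.2⟩ : Half M 0) hq
  have h₂ : (Opens.map (Tamarkin.translation M c)).obj U ≤
    (Opens.map (𝟙 (TopCat.of (M × ℝ)))).obj V := h'
  dsimp only [sumRest]
  rw [NatTrans.comp_app, NatTrans.comp_app, NatTrans.comp_app]
  refine (secMap_comp _ _ _ _).trans ?_
  refine (congrArg _ (secMap_restPullPush (Half.incl M hc) rfl rfl F U V h h₁ t)).trans ?_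
  refine (secMap_comp _ _ _ _).trans ?_
  refine (congrArg _ (secMap_restPullPush (Half.edge M c) rfl rfl F U V h₁ h₂ t)).trans ?_
  refine (secMap_comp _ _ _ _).trans ?_
  refine (secMap_res ((inverseId k _).hom.app F) h₂ _).trans ?_
  exact congrArg (res F h') (secMap_inverseId F V t)

/-- Pulling a section back along `p` and restricting it to `{v = c}` is restricting it along
`T_c`. -/
lemma lowerPull_comp_sumRest {c : ℝ} (hc : 0 ≤ c) :
    lowerPull k M ≫ Functor.whiskerRight (sumRest k M hc) (direct k (toLower M)) =
      lowerRest k M hc := by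
  ext F : 2
  refine hom_ext_secMap fun U s => ?_
  rw [NatTrans.comp_app]
  refine (secMap_comp _ _ _ _).trans ?_
  exact secMap_sumRest hc F ((Opens.map (toLower M)).obj U) ((Opens.map (toLower M)).obj U)
    (map_sum_le U) (map_translation_le hc U) s

variable (k M)

/-- The morphism `φ⁻¹ φ_* ⟶ s_* p⁻¹` adjoint to `lowerPull`. -/
def lowerComparison : direct k (toLower M) ⋙ inverse k (toLower M) ⟶
    inverse k (Half.proj M 0) ⋙ direct k (Half.sum M 0) :=
  Functor.whiskerRight (lowerPull k M) (inverse k (toLower M)) ≫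
    Functor.whiskerLeft (inverse k (Half.proj M 0) ⋙ direct k (Half.sum M 0))
      (inverseDirectAdj k (toLower M)).counit

variable {k M}

lemma lowerComparison_comp_sumRest {c : ℝ} (hc : 0 ≤ c) :
    lowerComparison k M ≫ sumRest k M hc =
      Functor.whiskerRight (lowerRest k M hc) (inverse k (toLower M)) ≫
        Functor.whiskerLeft (direct k (Tamarkin.translation M c))
          (inverseDirectAdj k (toLower M)).counit := by
  ext F : 2
  have h := congrArg (fun α => (inverse k (toLower M)).map (NatTrans.app α F))
    (lowerPull_comp_sumRest (k := k) (M := M) hc)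
  have h₂ := (inverseDirectAdj k (toLower M)).counit.naturality ((sumRest k M hc).app F)
  simp only [NatTrans.comp_app, CategoryTheory.Functor.map_comp] at h
  refine (Category.assoc _ _ _).trans ((whisker_eq _ h₂.symm).trans ?_)
  exact (Category.assoc _ _ _).symm.trans (eq_whisker h _)

/-- The open subset `V × ]-∞, b[` of `Lower M`. -/
def lowerBox (V : Opens M) (b : ℝ) : Opens (TopCat.of (Lower M)) where
  carrier := (V : Set M) ×ˢ Set.Iio b
  is_open' := ⟨V.isOpen.prod isOpen_Iio, fun _ _ _ ht h => ⟨h.1, lt_of_le_of_lt ht h.2⟩⟩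

lemma prodIoo_le_lowerBox (V : Opens M) (a b : ℝ) :
    prodIoo V a b ≤ (Opens.map (toLower M)).obj (lowerBox V b) := fun _ h => ⟨h.1, h.2.2⟩

lemma secMap_lowerComparison (F : Sh k (TopCat.of (M × ℝ))) (U : Opens (TopCat.of (Lower M)))
    (s : Sec ((direct k (toLower M)).obj F) U) :
    secMap ((lowerComparison k M).app F) _ (pullSec (toLower M) ((direct k (toLower M)).obj F) U s)
      = secMap ((lowerPull k M).app F) U s := by
  have h : (inverseDirectAdj k (toLower M)).unit.app ((direct k (toLower M)).obj F) ≫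
      (direct k (toLower M)).map ((lowerComparison k M).app F) = (lowerPull k M).app F := by
    dsimp only [lowerComparison]
    simp only [NatTrans.comp_app, CategoryTheory.Functor.map_comp, Functor.whiskerRight_app,
      Functor.whiskerLeft_app]
    have h₁ := (inverseDirectAdj k (toLower M)).unit.naturality ((lowerPull k M).app F)
    have h₂ := (inverseDirectAdj k (toLower M)).right_triangle_components
      ((inverse k (Half.proj M 0) ⋙ direct k (Half.sum M 0)).obj F)
    refine (Category.assoc _ _ _).symm.trans ((eq_whisker h₁.symm _).trans ?_)
    exact (Category.assoc _ _ _).trans ((whisker_eq _ h₂).trans (Category.comp_id _))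
  exact congrArg (fun φ => secMap φ U s) h

lemma box_le_map_sum (V : Opens M) (a b : ℝ) :
    box ((Opens.map (toLower M)).obj (lowerBox V b)) a b ≤
      (Opens.map (Half.sum M 0)).obj (prodIoo V a b) := fun _ h => ⟨h.1.1, h.2⟩

lemma map_sum_prodIoo_le (V : Opens M) (a b : ℝ) :
    (Opens.map (Half.sum M 0)).obj (prodIoo V a b) ≤
      box ((Opens.map (toLower M)).obj (lowerBox V b)) a b :=
  fun q h => ⟨⟨h.1, (le_add_of_nonneg_right q.2).trans_lt h.2.2⟩, h.2⟩

/-- A lower set which contains `V × ]a, b[` contains `V × ]-∞, b[`. -/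
lemma lowerBox_le {V : Opens M} {a b : ℝ} (hab : a < b) {U : Opens (TopCat.of (Lower M))}
    (h : prodIoo V a b ≤ (Opens.map (toLower M)).obj U) : lowerBox V b ≤ U := fun y hy => by
  obtain ⟨r, hr, hr'⟩ := exists_between (max_lt hab hy.2)
  exact mem_lower ((le_max_right _ _).trans hr.le)
    (@h (y.1, r) ⟨hy.1, (le_max_left _ _).trans_lt hr, hr'⟩)

lemma lowerComparison_injective (F : Sh k (TopCat.of (M × ℝ))) (V : Opens M) {a b : ℝ}
    (hab : a < b) {U : Opens (TopCat.of (Lower M))}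
    (hV : prodIoo V a b ≤ (Opens.map (toLower M)).obj U)
    (t : Sec ((direct k (toLower M)).obj F) U)
    (ht : secMap ((lowerComparison k M).app F) _ (res _ hV (pullSec (toLower M) _ U t)) = 0) :
    res _ hV (pullSec (toLower M) _ U t) = 0 := by
  have hU := lowerBox_le hab hV
  have hU' : (Opens.map (toLower M)).obj (lowerBox V b) ≤ (Opens.map (toLower M)).obj U :=
    fun _ h => hU h
  have h₁ : res ((inverse k (Half.proj M 0)).obj F)
      (((Opens.map (Half.sum M 0)).map (homOfLE hV)).le.trans (map_sum_le U))
        (pullSec (Half.proj M 0) F ((Opens.map (toLower M)).obj U) t) = 0 := by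
    refine Eq.trans ?_ ht
    refine Eq.trans ?_ (secMap_res ((lowerComparison k M).app F) hV _).symm
    refine Eq.trans ?_ (congrArg _ (secMap_lowerComparison F U t).symm)
    exact (res_res ((inverse k (Half.proj M 0)).obj F) _ _ _).symm
  have h₂ : res F hU' t = 0 := by
    have hlt : (Opens.map (toLower M)).obj (lowerBox V b) ≤ below M b :=
      fun y (hy : y ∈ (V : Set M) ×ˢ Set.Iio b) => hy.2
    apply pullBox_injective F hab hlt
    refine Eq.trans ?_ (map_zero _).symm
    refine (pullBox_res F (a := a) inf_le_left hU' t).trans ((pullBox_apply F _ t).trans ?_)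
    refine Eq.trans ?_ ((congrArg (res _ (box_le_map_sum V a b)) h₁).trans (map_zero _))
    exact (res_res ((inverse k (Half.proj M 0)).obj F) _ _ _).symm
  have h₃ : pullSec (toLower M) ((direct k (toLower M)).obj F) (lowerBox V b)
      (res ((direct k (toLower M)).obj F) hU t) = 0 := (congrArg _ h₂).trans (map_zero _)
  refine Eq.trans ?_ ((congrArg (res _ (prodIoo_le_lowerBox V a b)) h₃).trans (map_zero _))
  refine Eq.trans ?_ (congrArg _ (pullSec_res (toLower M) _ hU t)).symm
  exact (res_res _ _ _ _).symm

lemma lowerComparison_surjective (F : Sh k (TopCat.of (M × ℝ))) (V : Opens M) {a b : ℝ}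
    (hab : a < b)
    (t : Sec ((inverse k (Half.proj M 0) ⋙ direct k (Half.sum M 0)).obj F) (prodIoo V a b)) :
    ∃ s, secMap ((lowerComparison k M).app F) (prodIoo V a b) s = t := by
  obtain ⟨i, hi⟩ := pullBox_surjective F hab (res ((inverse k (Half.proj M 0)).obj F)
    (box_le_map_sum V a b) t)
  have hle : (Opens.map (toLower M)).obj (lowerBox V b) ≤
      (Opens.map (toLower M)).obj (lowerBox V b) ⊓ below M b := fun _ h => ⟨h, h.2⟩
  refine ⟨res _ (prodIoo_le_lowerBox V a b) (pullSec (toLower M) ((direct k (toLower M)).obj F)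
    (lowerBox V b) (res F hle i)), ?_⟩
  refine (secMap_res ((lowerComparison k M).app F) (prodIoo_le_lowerBox V a b) _).trans ?_
  refine (congrArg _ (secMap_lowerComparison F _ _)).trans ?_
  have h₁ : res ((inverse k (Half.proj M 0)).obj F) (map_sum_prodIoo_le V a b)
      (pullBox F (a := a) inf_le_left (res F hle i)) = t := by
    rw [pullBox_res F _ hle]
    refine (congrArg _ hi).trans ?_
    exact (res_res ((inverse k (Half.proj M 0)).obj F) _ _ t).trans
      (res_self ((inverse k (Half.proj M 0)).obj F) le_rfl t)
  refine Eq.trans ?_ h₁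
  rw [pullBox_apply, res_res]
  exact res_res ((inverse k (Half.proj M 0)).obj F) _ _ _

/-- The inverse image by the sum of `V × ]a, b[` is the box over `V × ]-∞, b[` given by
`a < t + v < b`, so that sections of `s_* p⁻¹ F` on `V × ]a, b[` are sections of `F` on
`V × ]-∞, b[`, which is the smallest open lower set containing `V × ]a, b[`. -/
instance isIso_lowerComparison_app (F : Sh k (TopCat.of (M × ℝ))) :
    IsIso ((lowerComparison k M).app F) := by
  apply isIso_of_locally_bijective
  · intro U s hs x hx
    obtain ⟨U', hU', t, W, hxW, hWU, hWU', e⟩ :=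
      exists_pullSec_eq (toLower M) ((direct k (toLower M)).obj F) s hx
    obtain ⟨V, α, β, hxV, hxab, hV⟩ := exists_prod_Ioo_le hxW
    have e' : res _ (hV.trans hWU) s =
        res _ (hV.trans hWU') (pullSec (toLower M) ((direct k (toLower M)).obj F) U' t) :=
      (res_res _ hWU hV s).symm.trans ((congrArg _ e).trans (res_res _ hWU' hV _))
    refine ⟨prodIoo V α β, Set.mk_mem_prod hxV hxab, hV.trans hWU, e'.trans ?_⟩
    refine lowerComparison_injective F V (hxab.1.trans hxab.2) (hV.trans hWU') t ?_
    refine (congrArg _ e'.symm).trans ?_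
    exact (secMap_res ((lowerComparison k M).app F) (hV.trans hWU) s).trans
      ((congrArg _ hs).trans (map_zero _))
  · intro U t x hx
    obtain ⟨V, α, β, hxV, hxab, hV⟩ := exists_prod_Ioo_le hx
    obtain ⟨s, hs⟩ := lowerComparison_surjective F V (hxab.1.trans hxab.2) (res _ hV t)
    exact ⟨prodIoo V α β, Set.mk_mem_prod hxV hxab, hV, s, hs⟩

instance isIso_lowerComparison : IsIso (lowerComparison k M) :=
  NatIso.isIso_of_isIso_app _

end Lower

/-! ### Natural transformations on complexes and on derived categories -/

section

variable {C D B : Type*} [Category* C] [Category* D] [Category* B] [Abelian C] [Abelian D]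
  [Abelian B]

lemma mapHomotopyPlusNatTrans_comp_app {F G H : C ⥤ D} [F.Additive] [G.Additive] [H.Additive]
    (α : F ⟶ G) (β : G ⟶ H) (K : HomotopyCategory.Plus C) :
    (mapHomotopyPlusNatTrans (α ≫ β)).app K =
      (mapHomotopyPlusNatTrans α).app K ≫ (mapHomotopyPlusNatTrans β).app K := by
  refine ObjectProperty.hom_ext _ ?_
  exact congrArg (fun t => t.app K.obj) (NatTrans.mapHomotopyCategory_comp (c := .up ℤ) α β)

lemma mapHomotopyPlusNatTrans_comp_app_eq_zero {F G H L : C ⥤ D} [F.Additive] [G.Additive]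
    [H.Additive] [L.Additive] (α : F ⟶ G) (β : G ⟶ H) (γ : H ⟶ L) (K : HomotopyCategory.Plus C)
    (h : (mapHomotopyPlusNatTrans β).app K = 0) :
    (mapHomotopyPlusNatTrans (α ≫ β ≫ γ)).app K = 0 := by
  rw [mapHomotopyPlusNatTrans_comp_app, mapHomotopyPlusNatTrans_comp_app, h, zero_comp, comp_zero]

lemma mapHomotopyCategoryPlus_map_zero (F : C ⥤ D) [F.Additive] (K L : HomotopyCategory.Plus C) :
    F.mapHomotopyCategoryPlus.map (0 : K ⟶ L) = 0 :=
  ObjectProperty.hom_ext _ ((F.mapHomotopyCategory (.up ℤ)).map_zero _ _)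

lemma mapHomotopyPlusNatTrans_id_app (F : C ⥤ D) [F.Additive] (K : HomotopyCategory.Plus C) :
    (mapHomotopyPlusNatTrans (𝟙 F)).app K = 𝟙 _ := by
  refine ObjectProperty.hom_ext _ ?_
  exact congrArg (fun t => t.app K.obj) (NatTrans.mapHomotopyCategory_id (c := .up ℤ) F)

lemma mapHomotopyCategoryPlusCompIso_hom_app {F : C ⥤ D} {G : D ⥤ B} {H : C ⥤ B} [F.Additive]
    [G.Additive] [H.Additive] (e : F ⋙ G ≅ H) (K : HomotopyCategory.Plus C) :
    (Functor.mapHomotopyCategoryPlusCompIso e).hom.app K =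
      (mapHomotopyPlusNatTrans e.hom).app K := by
  refine ObjectProperty.hom_ext _ ?_
  obtain ⟨K, rfl⟩ := HomotopyCategory.Plus.quotient_obj_surjective K
  rfl

lemma mapHomotopyCategoryPlusCompIso_refl_inv_app (F : C ⥤ D) (G : D ⥤ B) [F.Additive]
    [G.Additive] (K : HomotopyCategory.Plus C) :
    (Functor.mapHomotopyCategoryPlusCompIso (Iso.refl (F ⋙ G))).inv.app K =
      𝟙 ((F ⋙ G).mapHomotopyCategoryPlus.obj K) := by
  have h := (Functor.mapHomotopyCategoryPlusCompIso (Iso.refl (F ⋙ G))).hom_inv_id_app K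
  rw [mapHomotopyCategoryPlusCompIso_hom_app, Iso.refl_hom] at h
  have h' := mapHomotopyPlusNatTrans_id_app (F ⋙ G) K
  exact (Category.id_comp _).symm.trans ((eq_whisker h'.symm _).trans h)

lemma mapHomotopyPlusId_hom_app (K : HomotopyCategory.Plus C) :
    (mapHomotopyPlusId C).hom.app K = 𝟙 K := by
  refine ObjectProperty.hom_ext _ ?_
  obtain ⟨K, rfl⟩ := HomotopyCategory.Plus.quotient_obj_surjective K
  rfl

variable [HasDerivedCategory C] [HasDerivedCategory D] [HasDerivedCategory B]

lemma plusQh_map_zero (K L : HomotopyCategory.Plus C) :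
    (DerivedCategory.Plus.Qh (C := C)).map (0 : K ⟶ L) = 0 :=
  (DerivedCategory.Plus.Qh (C := C)).map_zero K L

lemma exactPlusComp_hom_app {F : C ⥤ D} {G : D ⥤ B} {K : C ⥤ B}
    [F.Additive] [PreservesFiniteLimits F] [PreservesFiniteColimits F]
    [G.Additive] [PreservesFiniteLimits G] [PreservesFiniteColimits G]
    [K.Additive] [PreservesFiniteLimits K] [PreservesFiniteColimits K]
    (e : F ⋙ G ≅ K) (L : HomotopyCategory.Plus C) :
    (exactPlusComp e).hom.app (DerivedCategory.Plus.Qh.obj L) =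
      ((exactPlus G).map ((exactPlusFactors F).hom.app L) ≫
        (exactPlusFactors G).hom.app (F.mapHomotopyCategoryPlus.obj L)) ≫
      DerivedCategory.Plus.Qh.map ((mapHomotopyPlusNatTrans e.hom).app L) ≫
      (exactPlusFactors K).inv.app L := by
  rw [← mapHomotopyCategoryPlusCompIso_hom_app]
  let _ : Localization.Lifting DerivedCategory.Plus.Qh (HomotopyCategory.Plus.quasiIso C)
      (F.mapHomotopyCategoryPlus ⋙ G.mapHomotopyCategoryPlus ⋙ DerivedCategory.Plus.Qh)
      (exactPlus F ⋙ exactPlus G) :=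
    ⟨(Functor.associator _ _ _).symm ≪≫ Functor.isoWhiskerRight (exactPlusFactors F) _ ≪≫
      Functor.associator _ _ _ ≪≫ Functor.isoWhiskerLeft _ (exactPlusFactors G)⟩
  let _ : Localization.Lifting DerivedCategory.Plus.Qh (HomotopyCategory.Plus.quasiIso C)
      (K.mapHomotopyCategoryPlus ⋙ DerivedCategory.Plus.Qh) (exactPlus K) :=
    ⟨exactPlusFactors K⟩
  refine (Localization.liftNatTrans_app _ _ _ _ _ _ _ _).trans ?_
  simp [Localization.Lifting.iso]

lemma exactPlusId_hom_app {F : C ⥤ C} [F.Additive] [PreservesFiniteLimits F]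
    [PreservesFiniteColimits F] (e : F ≅ 𝟭 C) (L : HomotopyCategory.Plus C) :
    (exactPlusId e).hom.app (DerivedCategory.Plus.Qh.obj L) =
      (exactPlusFactors F).hom.app L ≫
        DerivedCategory.Plus.Qh.map ((mapHomotopyPlusNatTrans e.hom).app L) := by
  let _ : Localization.Lifting DerivedCategory.Plus.Qh (HomotopyCategory.Plus.quasiIso C)
      (F.mapHomotopyCategoryPlus ⋙ DerivedCategory.Plus.Qh) (exactPlus F) :=
    ⟨exactPlusFactors F⟩
  let _ : Localization.Lifting DerivedCategory.Plus.Qh (HomotopyCategory.Plus.quasiIso C)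
      (𝟭 _ ⋙ DerivedCategory.Plus.Qh) (𝟭 (DerivedCategory.Plus C)) :=
    ⟨Functor.rightUnitor _ ≪≫ (Functor.leftUnitor _).symm⟩
  refine (Localization.liftNatTrans_app _ _ _ _ _ _ _ _).trans ?_
  simp only [Localization.Lifting.iso, Functor.isoWhiskerRight_hom, Functor.whiskerRight_app,
    Iso.trans_hom, NatTrans.comp_app, mapHomotopyPlusId_hom_app, Iso.trans_inv,
    Iso.symm_inv, Functor.leftUnitor_hom_app, Functor.rightUnitor_inv_app, Category.comp_id]
  refine whisker_eq ((exactPlusFactors F).hom.app L) ?_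
  exact (Category.comp_id _).trans (congrArg DerivedCategory.Plus.Qh.map (Category.comp_id _))

end

/-! ### The derived convolution on complexes -/

section

variable (k : Type u) [CommRing k] {X Y Z A : TopCat.{u}}

/-- The canonical morphism from the class of the complex `s_* p⁻¹ K` to `Rs_* p⁻¹ K`. -/
def canPull (p s : A ⟶ X) (K : HomotopyCategory.Plus (Sh k X)) :
    DerivedCategory.Plus.Qh.obj ((inverse k p ⋙ direct k s).mapHomotopyCategoryPlus.obj K) ⟶
      (pullPush k p s).obj (DerivedCategory.Plus.Qh.obj K) :=
  (direct k s).rightDerivedFunctorPlusUnit.app ((inverse k p).mapHomotopyCategoryPlus.obj K) ≫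
    (directPlus k s).map ((exactPlusFactors (inverse k p)).inv.app K)

/-- The derived morphism `Rf_* ⟶ R(f e)_* e⁻¹` is given by `f_* ⟶ (f e)_* e⁻¹` on complexes. -/
lemma unit_comp_directUnitPlus (e : Z ⟶ X) (f : X ⟶ Y) (K : HomotopyCategory.Plus (Sh k X)) :
    (direct k f).rightDerivedFunctorPlusUnit.app K ≫
      (directUnitPlus k e f).app (DerivedCategory.Plus.Qh.obj K) =
    DerivedCategory.Plus.Qh.map ((mapHomotopyPlusNatTrans (directUnit k e f)).app K) ≫
      (direct k (e ≫ f)).rightDerivedFunctorPlusUnit.app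
        ((inverse k e).mapHomotopyCategoryPlus.obj K) ≫
      (directPlus k (e ≫ f)).map ((exactPlusFactors (inverse k e)).inv.app K) := by
  refine (Functor.rightDerived_fac_app _ _ _ _ _ _).trans ?_
  simp only [NatTrans.comp_app, Functor.whiskerRight_app, Functor.whiskerLeft_app,
    Functor.associator_hom_app, Functor.associator_inv_app, Category.id_comp, Category.comp_id,
    mapHomotopyCategoryPlusCompIso_refl_inv_app]
  rfl

lemma pullPushRestrict_app {A' : TopCat.{u}} {p s : A ⟶ X} (e : A' ⟶ A) (F : Dplus k X) :
    (pullPushRestrict k (p := p) (s := s) e rfl rfl).app F =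
      (directUnitPlus k e s).app ((inversePlus k p).obj F) ≫
        (directPlus k (e ≫ s)).map ((exactPlusComp (inverseComp k e p)).hom.app F) := by
  exact whisker_eq ((directUnitPlus k e s).app ((inversePlus k p).obj F))
    ((Category.id_comp _).trans (Category.comp_id _))

/-- The diagram chase for `canPull_comp_pullPushRestrict`, where `R` is a derived direct image. It
is stated for arbitrary categories, as composition in `Sh k X` and in its ambient category of
sheaves are only definitionally equal. -/
lemma comp_eq_of_comparisons {C D : Type*} [Category* C] [Category* D] (R : C ⥤ D)
    {a b b' a₁ a₂ : D} {y y' z w w' : C} {u : a ⟶ b} {f : b ⟶ b'} {d : b ⟶ R.obj y}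
    {d' : b' ⟶ R.obj y'} {E : y ⟶ y'} {E' : y' ⟶ y} {c : y' ⟶ z} {q : a ⟶ a₁}
    {u₁ : a₁ ⟶ R.obj w} {g : w ⟶ y} {g' : y ⟶ w} {m : w ⟶ w'} {n : w' ⟶ z} {q' : a₁ ⟶ a₂}
    {u₂ : a₂ ⟶ R.obj w'} (h₁ : u ≫ d = q ≫ u₁ ≫ R.map g) (h₂ : f ≫ d' = d ≫ R.map E)
    (h₃ : c = (E' ≫ g') ≫ m ≫ n) (h₄ : q' ≫ u₂ = u₁ ≫ R.map m) (hE : E ≫ E' = 𝟙 _)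
    (hg : g ≫ g' = 𝟙 _) : (u ≫ f) ≫ d' ≫ R.map c = (q ≫ q') ≫ u₂ ≫ R.map n := by
  have h₅ : R.map g ≫ R.map E ≫ R.map c = R.map m ≫ R.map n := by
    simp only [← Functor.map_comp, h₃, Category.assoc, reassoc_of% hE, reassoc_of% hg]
  rw [Category.assoc, reassoc_of% h₂, reassoc_of% h₁, h₅, Category.assoc, reassoc_of% h₄]

/-- On complexes, the derived restriction morphism `Rs_* p⁻¹ ⟶ Rs'_* p'⁻¹` is given by
`restPullPush`. -/
lemma canPull_comp_pullPushRestrict {A' : TopCat.{u}} {p s : A ⟶ X} {p' s' : A' ⟶ X} (e : A' ⟶ A)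
    (hp : e ≫ p = p') (hs : e ≫ s = s') (K : HomotopyCategory.Plus (Sh k X)) :
    canPull k p s K ≫ (pullPushRestrict k e hp hs).app (DerivedCategory.Plus.Qh.obj K) =
      DerivedCategory.Plus.Qh.map ((mapHomotopyPlusNatTrans (restPullPush k e hp hs)).app K) ≫
        canPull k p' s' K := by
  subst hp hs
  have h₁ := unit_comp_directUnitPlus k e s ((inverse k p).mapHomotopyCategoryPlus.obj K)
  have h₂ := (directUnitPlus k e s).naturality ((exactPlusFactors (inverse k p)).inv.app K)
  have h₃ := exactPlusComp_hom_app (inverseComp k e p) K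
  have h₄ := (direct k (e ≫ s)).rightDerivedFunctorPlusUnit.naturality
    ((mapHomotopyPlusNatTrans (inverseComp k e p).hom).app K)
  have h₅ : (inversePlus k e).map ((exactPlusFactors (inverse k p)).inv.app K) ≫
      (inversePlus k e).map ((exactPlusFactors (inverse k p)).hom.app K) = 𝟙 _ := by
    rw [← Functor.map_comp, Iso.inv_hom_id_app, CategoryTheory.Functor.map_id]
  have h₆ := (exactPlusFactors (inverse k e)).inv_hom_id_app
    ((inverse k p).mapHomotopyCategoryPlus.obj K)
  rw [pullPushRestrict_app]
  refine (comp_eq_of_comparisons (directPlus k (e ≫ s)) h₁ h₂ h₃ h₄ h₅ h₆).trans ?_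
  refine eq_whisker ?_ (canPull k (e ≫ p) (e ≫ s) K)
  refine ((DerivedCategory.Plus.Qh (C := Sh k X)).map_comp _ _).symm.trans (congrArg _ ?_)
  dsimp only [restPullPush]
  rw [eqToHom_refl, Category.comp_id, mapHomotopyPlusNatTrans_comp_app]
  rfl

/-- On complexes, the isomorphism `Rs_* id⁻¹ ⟶ Rs_*` is given by `s_* id⁻¹ ⟶ s_*`. -/
lemma canPull_comp_inversePlusId (s : X ⟶ X) (K : HomotopyCategory.Plus (Sh k X)) :
    canPull k (𝟙 X) s K ≫ (directPlus k s).map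
        ((inversePlusId k X).hom.app (DerivedCategory.Plus.Qh.obj K)) =
      DerivedCategory.Plus.Qh.map ((mapHomotopyPlusNatTrans
        (Functor.whiskerRight (inverseId k X).hom (direct k s) ≫
          (Functor.leftUnitor _).hom)).app K) ≫
        (direct k s).rightDerivedFunctorPlusUnit.app K := by
  have h₁ := exactPlusId_hom_app (inverseId k X) K
  have h₂ := (direct k s).rightDerivedFunctorPlusUnit.naturality
    ((mapHomotopyPlusNatTrans (inverseId k X).hom).app K)
  have h₃ : (exactPlusFactors (inverse k (𝟙 X))).inv.app K ≫
      (inversePlusId k X).hom.app (DerivedCategory.Plus.Qh.obj K) =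
        DerivedCategory.Plus.Qh.map ((mapHomotopyPlusNatTrans (inverseId k X).hom).app K) := by
    refine (whisker_eq _ h₁).trans ((Category.assoc _ _ _).symm.trans ?_)
    exact (eq_whisker ((exactPlusFactors (inverse k (𝟙 X))).inv_hom_id_app K) _).trans
      (Category.id_comp _)
  refine (Category.assoc _ _ _).trans ?_
  refine (whisker_eq _ (((directPlus k s).map_comp _ _).symm.trans
    (congrArg _ h₃))).trans (h₂.symm.trans ?_)
  refine eq_whisker ?_ ((direct k s).rightDerivedFunctorPlusUnit.app K)
  refine congrArg DerivedCategory.Plus.Qh.map ?_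
  have h₄ : Functor.whiskerRight (inverseId k X).hom (direct k s) ≫ (Functor.leftUnitor _).hom =
      (Functor.whiskerRight (inverseId k X).hom (direct k s) :
        inverse k (𝟙 X) ⋙ direct k s ⟶ direct k s) := by
    ext F : 2
    exact Category.comp_id _
  exact congrArg (fun α => (mapHomotopyPlusNatTrans α).app K) h₄.symm

end

/-! ### A criterion for the vanishing of `τ` -/

section Criterion

variable (k : Type u) [CommRing k] (M : Type u) [TopologicalSpace M]

/-- On complexes, the morphism `F ⋆ k_{M × [0, ∞[} ⟶ T_{c*} F` is given by `sumRest`. -/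
lemma canPull_comp_convRestrict_comp_convEdge {c : ℝ} (hc : 0 ≤ c)
    (K : HomotopyCategory.Plus (Sh k (TopCat.of (M × ℝ)))) :
    canPull k (Half.proj M 0) (Half.sum M 0) K ≫
        (convRestrict k M hc).app (DerivedCategory.Plus.Qh.obj K) ≫
          (convEdge k M c).app (DerivedCategory.Plus.Qh.obj K) =
      DerivedCategory.Plus.Qh.map ((mapHomotopyPlusNatTrans (sumRest k M hc)).app K) ≫
        (direct k (translation M c)).rightDerivedFunctorPlusUnit.app K := by
  have h₁ := canPull_comp_pullPushRestrict k (p := Half.proj M 0) (s := Half.sum M 0)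
    (p' := Half.proj M c) (s' := Half.sum M c) (Half.incl M hc) rfl rfl K
  have h₂ := canPull_comp_pullPushRestrict k (p := Half.proj M c) (s := Half.sum M c)
    (p' := 𝟙 _) (s' := translation M c) (Half.edge M c) rfl rfl K
  have h₃ := canPull_comp_inversePlusId k (translation M c) K
  have h₄ : (convEdge k M c).app (DerivedCategory.Plus.Qh.obj K) =
      (pullPushRestrict k (p' := 𝟙 _) (s' := translation M c) (Half.edge M c) rfl rfl).app
        (DerivedCategory.Plus.Qh.obj K) ≫ (directPlus k (translation M c)).map
          ((inversePlusId k _).hom.app (DerivedCategory.Plus.Qh.obj K)) :=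
    whisker_eq _ (Category.comp_id _)
  have h₅ : (mapHomotopyPlusNatTrans (sumRest k M hc)).app K = _ :=
    (mapHomotopyPlusNatTrans_comp_app _ _ K).trans
      (whisker_eq _ (mapHomotopyPlusNatTrans_comp_app _ _ K))
  rw [h₄, h₅]
  refine (Category.assoc _ _ _).symm.trans ?_
  refine (eq_whisker h₁ _).trans ?_
  refine (Category.assoc _ _ _).trans ?_
  refine (whisker_eq _ ((Category.assoc _ _ _).symm.trans
    ((eq_whisker h₂ _).trans ((Category.assoc _ _ _).trans
      (whisker_eq _ h₃))))).trans ?_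
  simp only [← Category.assoc]
  refine eq_whisker ?_ _
  rw [← Functor.map_comp, ← Functor.map_comp, Category.assoc]

variable {k M}

/-- For a complex `I` of injective sheaves, `Rs_* p⁻¹ I = s_* p⁻¹ I`. -/
lemma isIso_canPull (I : HomotopyCategory.Plus (InjectiveObject (Sh k (TopCat.of (M × ℝ))))) :
    IsIso (canPull k (Half.proj M 0) (Half.sum M 0)
      ((InjectiveObject.ι _).mapHomotopyCategoryPlus.obj I)) := by
  have : IsIso ((direct k (Half.sum M 0)).rightDerivedFunctorPlusUnit.app
      ((inverse k (Half.proj M 0)).mapHomotopyCategoryPlus.obj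
        ((InjectiveObject.ι _).mapHomotopyCategoryPlus.obj I))) :=
    isIso_unit_sum _ fun n => @boxFlabby_inverse_of_injective _ _ _ _ _
      (inferInstanceAs (Injective
        (((InjectiveObject.ι _).mapHomotopyCategoryPlus.obj I).obj.as.X n)))
  exact IsIso.comp_isIso' this (inferInstanceAs (IsIso ((directPlus k (Half.sum M 0)).mapIso
    ((exactPlusFactors (inverse k (Half.proj M 0))).symm.app _)).hom))

/-- As `s_* p⁻¹ = φ⁻¹ φ_*`, the morphisms `s_* p⁻¹ ⟶ T_{c*}` and `φ_* ⟶ φ_* T_{c*}` are adjoint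
to each other; hence one is homotopic to zero on a complex if and only if the other one is. -/
lemma mapHomotopyPlus_sumRest_eq_zero_iff {c : ℝ} (hc : 0 ≤ c)
    (K : HomotopyCategory.Plus (Sh k (TopCat.of (M × ℝ)))) :
    (mapHomotopyPlusNatTrans (sumRest k M hc)).app K = 0 ↔
      (mapHomotopyPlusNatTrans (lowerRest k M hc)).app K = 0 := by
  have h' : sumRest k M hc = inv (lowerComparison k M) ≫
      Functor.whiskerRight (lowerRest k M hc) (inverse k (toLower M)) ≫
        Functor.whiskerLeft (direct k (translation M c))
          (inverseDirectAdj k (toLower M)).counit :=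
    (IsIso.eq_inv_comp _).2 (lowerComparison_comp_sumRest hc)
  constructor
  · intro h
    have h₁ : (direct k (toLower M)).mapHomotopyCategoryPlus.map
        ((mapHomotopyPlusNatTrans (sumRest k M hc)).app K) = 0 := by
      rw [h, mapHomotopyCategoryPlus_map_zero]
    rw [← lowerPull_comp_sumRest]
    refine (mapHomotopyPlusNatTrans_comp_app (lowerPull k M)
      (Functor.whiskerRight (sumRest k M hc) (direct k (toLower M))) K).trans ?_
    exact (whisker_eq _ h₁).trans comp_zero
  · intro h
    rw [h']
    have h₁ : (inverse k (toLower M)).mapHomotopyCategoryPlus.map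
        ((mapHomotopyPlusNatTrans (lowerRest k M hc)).app K) = 0 := by
      rw [h, mapHomotopyCategoryPlus_map_zero]
    exact mapHomotopyPlusNatTrans_comp_app_eq_zero (inv (lowerComparison k M))
      (Functor.whiskerRight (lowerRest k M hc) (inverse k (toLower M)))
      (Functor.whiskerLeft (direct k (translation M c)) (inverseDirectAdj k (toLower M)).counit)
      K h₁

lemma isKInjective_map_direct (f : TopCat.of (M × ℝ) ⟶ TopCat.of (M × ℝ))
    (I : HomotopyCategory.Plus (InjectiveObject (Sh k (TopCat.of (M × ℝ))))) :
    CochainComplex.IsKInjective ((direct k f).mapHomotopyCategoryPlus.obj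
      ((InjectiveObject.ι _).mapHomotopyCategoryPlus.obj I)).obj.as := by
  obtain ⟨⟨I, n, _⟩, rfl⟩ := HomotopyCategory.Plus.quotient_obj_surjective I
  let L := ((InjectiveObject.ι _ ⋙ direct k f).mapHomologicalComplex (.up ℤ)).obj I
  have : CochainComplex.IsStrictlyGE L n := by dsimp only [L]; infer_instance
  have (i : ℤ) : Injective (L.X i) := by
    have : Injective ((InjectiveObject.ι _).obj (I.X i)) := inferInstance
    exact Injective.injective_of_adjoint (inverseDirectAdj k f) _
  exact CochainComplex.isKInjective_of_injective L n

lemma eq_zero_iff_of_comp_eq {C : Type*} [Category* C] [HasZeroMorphisms C] {x x' y y' : C}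
    {u : x ⟶ x'} {v : y ⟶ y'} [IsIso u] [IsIso v] {f : x' ⟶ y'} {g : x ⟶ y}
    (h : u ≫ f = g ≫ v) : f = 0 ↔ g = 0 := by
  rw [← cancel_epi u, h, comp_zero, ← cancel_mono v, zero_comp]

/-- For a complex `I` of injective sheaves, `τ_{0,c}(I)` vanishes if and only if the restriction
morphism `φ_* I ⟶ φ_* T_{c*} I` is homotopic to zero. -/
lemma isTau_zero_iff {c : ℝ} (hc : 0 ≤ c)
    (I : HomotopyCategory.Plus (InjectiveObject (Sh k (TopCat.of (M × ℝ))))) :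
    IsTau k M hc (injPlus.obj I) 0 ↔ (mapHomotopyPlusNatTrans (lowerRest k M hc)).app
      ((InjectiveObject.ι _).mapHomotopyCategoryPlus.obj I) = 0 := by
  rw [← mapHomotopyPlus_sumRest_eq_zero_iff]
  let K := (InjectiveObject.ι (Sh k (TopCat.of (M × ℝ)))).mapHomotopyCategoryPlus.obj I
  have : IsIso (canPull k (Half.proj M 0) (Half.sum M 0) K) := isIso_canPull I
  have : IsIso ((direct k (translation M c)).rightDerivedFunctorPlusUnit.app K) := by
    dsimp only [K]; infer_instance
  have e := canPull_comp_convRestrict_comp_convEdge k M hc K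
  have h₁ : IsTau k M hc (injPlus.obj I) 0 ↔
      (convRestrict k M hc).app (DerivedCategory.Plus.Qh.obj K) ≫
        (convEdge k M c).app (DerivedCategory.Plus.Qh.obj K) = 0 := by
    dsimp only [IsTau]
    rw [comp_zero]
    exact eq_comm
  rw [h₁]
  trans DerivedCategory.Plus.Qh.map ((mapHomotopyPlusNatTrans (sumRest k M hc)).app K) = 0
  · exact @eq_zero_iff_of_comp_eq _ _ _ _ _ _ _ _ _ (isIso_canPull I) this _ _ e
  · have hK := isKInjective_map_direct (k := k) (translation M c) I
    have := (DerivedCategory.Plus.Qh_map_bijective_of_isKInjective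
      ((inverse k (Half.proj M 0) ⋙ direct k (Half.sum M 0)).mapHomotopyCategoryPlus.obj K) _ hK).1
    constructor
    · intro h
      exact this (h.trans (plusQh_map_zero _ _).symm)
    · intro h
      rw [h, plusQh_map_zero]

end Criterion

/-! ### The complexes which are killed by a restriction morphism -/

section

lemma natTrans_app_eq_zero_of_iso {C D : Type*} [Category* C] [Category* D]
    [HasZeroMorphisms D] {F G : C ⥤ D} (α : F ⟶ G) {K L : C} (e : K ≅ L) (h : α.app K = 0) :
    α.app L = 0 := by
  have : α.app L = F.map e.inv ≫ α.app K ≫ G.map e.hom := by simp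
  rw [this, h, zero_comp, comp_zero]

variable {C D : Type*} [Category* C] [Category* D] [Abelian C] [Abelian D]

lemma mapHomotopyPlusNatTrans_app_shift_eq_zero {F G : C ⥤ D} [F.Additive] [G.Additive]
    (α : F ⟶ G) (K : HomotopyCategory.Plus C) (h : (mapHomotopyPlusNatTrans α).app K = 0) (n : ℤ) :
    (mapHomotopyPlusNatTrans α).app (K⟦n⟧) = 0 := by
  obtain ⟨⟨K, hK⟩, rfl⟩ := HomotopyCategory.Plus.quotient_obj_surjective K
  have h₁ : (HomotopyCategory.quotient D (.up ℤ)).map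
      ((NatTrans.mapHomologicalComplex α (.up ℤ)).app K) = 0 :=
    congrArg (fun f => f.hom) h
  have h₂ : (NatTrans.mapHomologicalComplex α (.up ℤ)).app (K⟦n⟧) =
      (F.mapCochainComplexShiftIso n).hom.app K ≫
        ((NatTrans.mapHomologicalComplex α (.up ℤ)).app K)⟦n⟧' ≫
          (G.mapCochainComplexShiftIso n).inv.app K := by
    ext i
    exact ((Category.id_comp _).trans (Category.comp_id _)).symm
  have h₃ : (HomotopyCategory.quotient D (.up ℤ)).map
      (((NatTrans.mapHomologicalComplex α (.up ℤ)).app K)⟦n⟧') = 0 := by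
    have := ((HomotopyCategory.quotient D (.up ℤ)).commShiftIso n).hom.naturality
      ((NatTrans.mapHomologicalComplex α (.up ℤ)).app K)
    rw [← cancel_mono (((HomotopyCategory.quotient D (.up ℤ)).commShiftIso n).hom.app _)]
    refine this.trans ?_
    dsimp only [Functor.comp_map]
    rw [h₁, Functor.map_zero, comp_zero, zero_comp]
  refine ObjectProperty.hom_ext _ ?_
  refine natTrans_app_eq_zero_of_iso (NatTrans.mapHomotopyCategory α (.up ℤ))
    (((HomotopyCategory.quotient C (.up ℤ)).commShiftIso n).app K ≪≫
      ((HomotopyCategory.Plus.ι C).commShiftIso n).symm.app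
        ((HomotopyCategory.Plus.quotient C).obj ⟨K, hK⟩)) ?_
  change (HomotopyCategory.quotient D (.up ℤ)).map
    ((NatTrans.mapHomologicalComplex α (.up ℤ)).app (K⟦n⟧)) = 0
  rw [h₂, Functor.map_comp, Functor.map_comp, h₃, zero_comp, comp_zero]

lemma mapHomotopyPlusNatTrans_app_zero {F G : C ⥤ D} [F.Additive] [G.Additive] (α : F ⟶ G) :
    (mapHomotopyPlusNatTrans α).app 0 = 0 :=
  (F.mapHomotopyCategoryPlus.map_isZero (isZero_zero _)).eq_of_src _ _

/-- If `α` vanishes on the third term of a distinguished triangle and `β` on the first one, then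
`α ≫ β` vanishes on the second one. -/
lemma mapHomotopyPlusNatTrans_comp_app_eq_zero_of_distinguished {F G H : C ⥤ D} [F.Additive]
    [G.Additive] [H.Additive] (α : F ⟶ G) (β : G ⟶ H)
    (T : Pretriangulated.Triangle (HomotopyCategory.Plus C))
    (hT : T ∈ Pretriangulated.distinguishedTriangles)
    (h₁ : (mapHomotopyPlusNatTrans β).app T.obj₁ = 0)
    (h₃ : (mapHomotopyPlusNatTrans α).app T.obj₃ = 0) :
    (mapHomotopyPlusNatTrans (α ≫ β)).app T.obj₂ = 0 := by
  obtain ⟨γ, hγ⟩ := Pretriangulated.Triangle.coyoneda_exact₂ _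
    (G.mapHomotopyCategoryPlus.map_distinguished T hT) ((mapHomotopyPlusNatTrans α).app T.obj₂) (by
      refine ((mapHomotopyPlusNatTrans α).naturality T.mor₂).symm.trans ?_
      rw [h₃, comp_zero]
      rfl)
  have h := (mapHomotopyPlusNatTrans β).naturality T.mor₁
  rw [h₁, zero_comp] at h
  rw [mapHomotopyPlusNatTrans_comp_app, hγ]
  exact (Category.assoc _ _ _).trans ((whisker_eq γ h).trans comp_zero)

end

section

variable {k : Type u} [CommRing k] {X Y Z : TopCat.{u}}

lemma restDirect_app_eq_zero_congr {f g f' g' : X ⟶ Y} (hf : f = f') (hg : g = g')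
    (h : ∀ U, (Opens.map g).obj U ≤ (Opens.map f).obj U)
    (h' : ∀ U, (Opens.map g').obj U ≤ (Opens.map f').obj U) (K : HomotopyCategory.Plus (Sh k X))
    (hK : (mapHomotopyPlusNatTrans (restDirect k h)).app K = 0) :
    (mapHomotopyPlusNatTrans (restDirect k h')).app K = 0 := by
  subst hf hg
  exact hK

/-- Direct images of restriction morphisms are restriction morphisms. -/
lemma restDirect_app_eq_zero_comp {f g : X ⟶ Y} (t : Y ⟶ Z)
    (h : ∀ U, (Opens.map g).obj U ≤ (Opens.map f).obj U)
    (h' : ∀ U, (Opens.map (g ≫ t)).obj U ≤ (Opens.map (f ≫ t)).obj U)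
    (K : HomotopyCategory.Plus (Sh k X))
    (hK : (mapHomotopyPlusNatTrans (restDirect k h)).app K = 0) :
    (mapHomotopyPlusNatTrans (restDirect k h')).app K = 0 := by
  have : (direct k t).mapHomotopyCategoryPlus.map
      ((mapHomotopyPlusNatTrans (restDirect k h)).app K) = 0 := by
    rw [hK, mapHomotopyCategoryPlus_map_zero]
  exact this

end

section

variable (k : Type u) [CommRing k] (M : Type u) [TopologicalSpace M]

/-- The bounded below complexes of sheaves `K` such that the restriction morphism
`φ_* K ⟶ φ_* T_{c*} K` is homotopic to zero for some `c ≥ 0`. -/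
def lowerTorsion : ObjectProperty (HomotopyCategory.Plus (Sh k (TopCat.of (M × ℝ)))) :=
  fun K => ∃ (c : ℝ) (hc : 0 ≤ c), (mapHomotopyPlusNatTrans (lowerRest k M hc)).app K = 0

instance : (lowerTorsion k M).IsClosedUnderIsomorphisms where
  of_iso e := fun ⟨c, hc, h⟩ => ⟨c, hc, natTrans_app_eq_zero_of_iso _ e h⟩

instance : (lowerTorsion k M).IsTriangulated where
  exists_zero := ⟨0, isZero_zero _, 0, le_rfl, mapHomotopyPlusNatTrans_app_zero _⟩
  isStableUnderShiftBy n := ⟨fun _ ⟨c, hc, h⟩ =>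
    ⟨c, hc, mapHomotopyPlusNatTrans_app_shift_eq_zero _ _ h n⟩⟩
  toIsTriangulatedClosed₂ := .mk' (fun T hT ⟨c, hc, h₁⟩ ⟨d, hd, h₃⟩ => by
    -- The restriction morphism from level `d` to level `c + d` is the direct image by a translation
    -- of the restriction morphism for `c`.
    have h (U : Opens (TopCat.of (Lower M))) :
        (Opens.map (translation M c ≫ toLower M ≫ Lower.translation M d)).obj U ≤
          (Opens.map (translation M d ≫ toLower M)).obj U :=
      fun p hp => mem_lower (by
        change p.2 + d ≤ p.2 + c + d
        linarith) hp
    have h' (U : Opens (TopCat.of (Lower M))) :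
        (Opens.map (translation M (c + d) ≫ toLower M)).obj U ≤
          (Opens.map (translation M d ≫ toLower M)).obj U := by
      rw [← toLower_translation]
      exact h U
    have hr : (mapHomotopyPlusNatTrans (restDirect k h')).app T.obj₁ = 0 :=
      restDirect_app_eq_zero_congr rfl (toLower_translation M c d) h _ _
        (restDirect_app_eq_zero_comp (f := toLower M) (g := translation M c ≫ toLower M)
          (Lower.translation M d) (map_translation_le hc) h _ h₁)
    refine ⟨c + d, add_nonneg hc hd, ?_⟩
    have := mapHomotopyPlusNatTrans_comp_app_eq_zero_of_distinguished (lowerRest k M hd)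
      (restDirect k h') T hT hr h₃
    rwa [lowerRest, restDirect_comp _ _ (map_translation_le (add_nonneg hc hd))] at this)

end

/-! ### Quotients by triangulated subcategories -/

section

variable {C : Type*} [Category* C] [HasZeroObject C] [HasShift C ℤ] [Preadditive C]
  [∀ n : ℤ, (shiftFunctor C n).Additive] [Pretriangulated C] [IsTriangulated C]

/-- The localization functor is fully faithful on the left orthogonal of `N`, so that the image of a
triangulated subcategory of this left orthogonal is triangulated. -/
lemma map_trW_Q_isTriangulated (N P : ObjectProperty C) [N.IsTriangulated] [P.IsTriangulated]
    (hP : P ≤ N.leftOrthogonal) : (P.map N.trW.Q).IsTriangulated := by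
  have : (P.ι ⋙ N.trW.Q).Full := ⟨fun {X Y} f => by
    obtain ⟨g, hg⟩ := ((hP _ X.property).map_bijective_of_isTriangulated N.trW.Q Y.obj).surjective f
    exact ⟨P.homMk g, hg⟩⟩
  rw [← Functor.essImage_ι_comp]
  infer_instance

lemma isTriangulatedTarget_trW_Q (P : ObjectProperty C) [P.IsTriangulated] :
    IsTriangulatedTarget P.trW.Q :=
  ⟨inferInstance, inferInstance, inferInstance, inferInstance, inferInstance, inferInstance,
    inferInstance, inferInstance⟩

end

/-! ### Torsion objects -/

section

variable {C : Type*} [Category* C] [Abelian C] [EnoughInjectives C] [HasDerivedCategory C]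

/-- A property of objects of `D⁺(C)` is triangulated if, on complexes of injective objects, it is
the restriction of a triangulated property of bounded below complexes up to homotopy. -/
lemma isTriangulated_of_inverseImage_injPlus (P : ObjectProperty (DerivedCategory.Plus C))
    [P.IsClosedUnderIsomorphisms] (L : ObjectProperty (HomotopyCategory.Plus C))
    [L.IsTriangulated] [L.IsClosedUnderIsomorphisms]
    (h : P.inverseImage injPlus =
      L.inverseImage (InjectiveObject.ι C).mapHomotopyCategoryPlus) : P.IsTriangulated := by
  have h' : P = (P.inverseImage injPlus).map injPlus := by
    ext F
    rw [ObjectProperty.prop_map_iff]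
    refine ⟨fun hF => ⟨injPlus.objPreimage F, ?_, ⟨injPlus.objObjPreimageIso F⟩⟩, ?_⟩
    · exact P.prop_of_iso (injPlus.objObjPreimageIso F).symm hF
    · rintro ⟨I, hI, ⟨e⟩⟩
      exact P.prop_of_iso e hI
  rw [h', h]
  infer_instance

end

section

variable (k : Type u) [CommRing k] (M : Type u) [TopologicalSpace M]

/-- The objects `F` of `D⁺(k_{M × ℝ})` such that `τ_{0,c}(F) = 0` for some `c ≥ 0`, without any
condition on the microsupport. -/
def plusTorsion : ObjectProperty (Dplus k (TopCat.of (M × ℝ))) :=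
  fun F => ∃ (c : ℝ) (h : 0 ≤ c), IsTau k M h F 0

instance : (plusTorsion k M).IsClosedUnderIsomorphisms where
  of_iso e := fun ⟨c, hc, h⟩ => ⟨c, hc, comp_zero.trans
    (natTrans_app_eq_zero_of_iso (convRestrict k M hc ≫ convEdge k M c) e
      (h.symm.trans comp_zero)).symm⟩

lemma plusTorsion_inverseImage_injPlus :
    (plusTorsion k M).inverseImage injPlus =
      (lowerTorsion k M).inverseImage
        (InjectiveObject.ι (Sh k (TopCat.of (M × ℝ)))).mapHomotopyCategoryPlus := by
  ext I
  exact exists_congr fun c => exists_congr fun hc => isTau_zero_iff hc I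

instance : (plusTorsion k M).IsTriangulated :=
  isTriangulated_of_inverseImage_injPlus _ (lowerTorsion k M) (plusTorsion_inverseImage_injPlus k M)

variable {E H : Type*} [NormedAddCommGroup E] [NormedSpace ℝ E] [TopologicalSpace H]
  (I : ModelWithCorners ℝ E H) [ChartedSpace H M] [IsManifold I 1 M]

lemma torsion_eq_inverseImage : torsion k M I =
    (plusTorsion k M).inverseImage ((tauNonneg k M I).ι ⋙ boundedToPlus) := rfl

instance : (torsion k M I).IsTriangulated := by
  rw [torsion_eq_inverseImage]
  infer_instance

instance : (torsion k M I).IsClosedUnderIsomorphisms := by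
  rw [torsion_eq_inverseImage]
  infer_instance

lemma torsionGamma_eq_map : torsionGamma k M I =
    ((tauNonpos k M I).leftOrthogonal ⊓
      (tauNonneg k M I ⊓ (plusTorsion k M).inverseImage boundedToPlus)).map (DbGamma.Q k M I) := by
  ext Y
  rw [ObjectProperty.prop_map_iff]
  exact ⟨fun ⟨F, h₁, h₂, e⟩ => ⟨F.obj, ⟨h₁, F.property, h₂⟩, e⟩,
    fun ⟨F, ⟨h₁, h, h₂⟩, e⟩ => ⟨⟨F, h⟩, h₁, h₂, e⟩⟩

instance : (torsionGamma k M I).IsTriangulated := by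
  rw [torsionGamma_eq_map]
  exact map_trW_Q_isTriangulated _ _ inf_le_left

instance : (torsionGamma k M I).IsClosedUnderIsomorphisms := by
  rw [torsionGamma_eq_map]
  infer_instance

end

end Tamarkin

end

theorem mainTheorem8 (k : Type u) [CommRing k]
    (hk : ∃ d : ℕ, ∀ N : ModuleCat.{u} k, HasProjectiveDimensionLE N d)
    (n : ℕ) (M : Type u) [TopologicalSpace M] [T2Space M] [SecondCountableTopology M]
    [ChartedSpace (EuclideanSpace ℝ (Fin n)) M] [IsManifold (𝓡 n) ∞ M] :
    Tamarkin.IsNullSystem (Tamarkin.torsion k M (𝓡 n)) ∧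
    Tamarkin.IsNullSystem (Tamarkin.torsionGamma k M (𝓡 n)) ∧
    Tamarkin.IsTriangulatedTarget (Tamarkin.TorsionLocalized.Q k M (𝓡 n)) :=
  ⟨⟨inferInstance, inferInstance⟩, ⟨inferInstance, inferInstance⟩,
    Tamarkin.isTriangulatedTarget_trW_Q _⟩
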